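/- **Setting.** Let $k\ge 1$ and $s\ge 2$ be integers. The convolutional network of depth $n$ with filter size $2k+1$ and stride $s$ has layers $0,1,\dots,n$. Layer $n$ consists of a single output node. If layer $t\geq 1$ has $w$ nodes, numbered $0,\dots,w-1$, then layer $t-1$ has $s(w-1)+2k+1$ nodes, and the children of node $i$ of layer $t$ are the $2k+1$ nodes $si,si+1,\dots,si+2k$ of layer $t-1$. Let $N_n$ be the number of nodes of layer $0$. Given filters $\varphi_1,\dots,\varphi_n:\{\pm1\}^{2k+1}\to\{\pm1\}$, the network induces a Boolean function $f_n:\{\pm1\}^{N_n}\to\{\pm1\}$: the nodes of layer $0$ carry the input bits, every node of layer $t$ carries the value of $\varphi_t$ at the values of its children (in order), and $f_n$ is the value of the output node. If every $\varphi_t$ is the majority function $\mathrm{maj}_{2k+1}$, then $f_n$ is the convolutional iterated $(2k+1)$-majority function with stride $s$. Let $\omega$ be uniform on $\{\pm1\}^{N_n}$ and let $\omega^\varepsilon$ arise from $\omega$ by flipping each coordinate independently with probability $\varepsilon$. Boolean functions $f_n$ are *noise sensitive* if $\mathrm{Cov}(f_n(\omega),f_n(\omega^\varepsilon))\to 0$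 as $n\to\infty$ for every $0<\varepsilon\le 1/2$. Random Boolean functions $f_n$, independent of $(\omega,\omega^\varepsilon)$, are *annealed noise sensitive* if for every $0<\varepsilon\le1/2$ the covariance of $f_n(\omega)$ and $f_n(\omega^\varepsilon)$, taken over $f_n$, $\omega$ and $\omega^\varepsilon$ together, tends to $0$; they are *quenched noise sensitive* if for all $0<\varepsilon\le 1/2$ and $\delta>0$ there is $n_0$ such that for all $n\ge n_0$, with probability at least $1-\delta$, $f_n$ is such that $\mathrm{Cov}_{\omega,\omega^\varepsilon}(f_n(\omega),f_n(\omega^\varepsilon))\le\delta$. **Theorem.** Let $k\ge1$ and $s\ge 2$. 1. The sequence of convolutional iterated $(2k+1)$-majority functions with stride $s$ is noise sensitive. 2. In these networks every node has at most $2k$ ancestors in every layer. 3. Let $\theta_1,\theta_2,\dots$ be independent random vectors in $\mathbb R^{2k+1}$ such that, for every $t$, almost surely $\sum_r\theta_{t,r}x_r\ne0$ for all $x\in\{\pm1\}^{2k+1}$, and let $f_n$ be the random Boolean function induced by the filters $\varphi_t(x)=\mathrm{sign}\left(\sum_r\theta_{t,r}x_r\right)$, $t=1,\dots,n$. If there is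 $c>0$ such that $\mathrm P(\varphi_t=\mathrm{maj}_{2k+1})\ge c$ for all $t$, then $(f_n)$ is annealed and quenched noise sensitive. -/

import Mathlib

open MeasureTheory ProbabilityTheory Filter Topology

noncomputable section

namespace ConvMaj

/-- A bit is a `Bool`; `true` stands for `+1` and `false` for `-1`. -/
def sgn (b : Bool) : ℝ := if b then 1 else -1

/-! ### Noise sensitivity -/

/-- The law on `Bool` that gives mass `p` to `true` and `1 - p` to `false`. -/
def coin (p : ℝ) : Measure Bool :=
  ENNReal.ofReal p • Measure.dirac true + ENNReal.ofReal (1 - p) • Measure.dirac false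

/-- The joint law of `(ω, ω^ε)`: `ω` is uniform on `{±1}^N`, and `ω^ε` is obtained from `ω` by
flipping every coordinate independently with probability `ε`. -/
def noiseLaw (N : ℕ) (ε : ℝ) : Measure ((Fin N → Bool) × (Fin N → Bool)) :=
  ((Measure.pi fun _ : Fin N => coin (1 / 2)).prod (Measure.pi fun _ : Fin N => coin ε)).map
    fun p => (p.1, fun i => xor (p.1 i) (p.2 i))

/-- `Cov(f(ω), f(ω^ε))`. -/
def noiseCov {N : ℕ} (f : (Fin N → Bool) → Bool) (ε : ℝ) : ℝ :=
  covariance (fun p => sgn (f p.1)) (fun p => sgn (f p.2)) (noiseLaw N ε)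

/-- The sequence `f n : {±1}^(N n) → {±1}` is noise sensitive. -/
def NoiseSensitive (N : ℕ → ℕ) (f : ∀ n, (Fin (N n) → Bool) → Bool) : Prop :=
  ∀ ε : ℝ, 0 < ε → ε ≤ 1 / 2 → Tendsto (fun n => noiseCov (f n) ε) atTop (𝓝 0)

/-- The laws `π n` on the Boolean functions on `{±1}^(N n)` are quenched noise sensitive. -/
def QuenchedNoiseSensitive (N : ℕ → ℕ)
    (π : ∀ n, Measure ((Fin (N n) → Bool) → Bool)) : Prop :=
  ∀ ε : ℝ, 0 < ε → ε ≤ 1 / 2 → ∀ δ : ℝ, 0 < δ → ∃ n₀ : ℕ, ∀ n, n₀ ≤ n →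
    1 - δ ≤ (π n).real {f | noiseCov f ε ≤ δ}

/-- The laws `π n` on the Boolean functions on `{±1}^(N n)` are annealed noise sensitive: the
covariance is taken over the random function (independent of the bits) and over `(ω, ω^ε)`. -/
def AnnealedNoiseSensitive (N : ℕ → ℕ)
    (π : ∀ n, Measure ((Fin (N n) → Bool) → Bool)) : Prop :=
  ∀ ε : ℝ, 0 < ε → ε ≤ 1 / 2 →
    Tendsto (fun n => covariance (fun q => sgn (q.1 q.2.1)) (fun q => sgn (q.1 q.2.2))
      ((π n).prod (noiseLaw (N n) ε))) atTop (𝓝 0)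

/-! ### The convolutional graph

Nodes of a layer are numbered from `0`. With filter size `2k+1` and stride `s`, node `i` of a layer
has the `2k+1` children `s*i, s*i+1, …, s*i+2k` in the layer below. -/

/-- The number of nodes in the layer that lies `m` layers below the single output node. -/
def width (k s : ℕ) : ℕ → ℕ
  | 0 => 1
  | m + 1 => s * (width k s m - 1) + (2 * k + 1)

theorem child_lt_width (k s m : ℕ) (i : Fin (width k s m)) (r : Fin (2 * k + 1)) :
    s * (i : ℕ) + (r : ℕ) < width k s (m + 1) := by
  have h : s * (i : ℕ) ≤ s * (width k s m - 1) := Nat.mul_le_mul_left _ (by omega)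
  have hr := r.isLt
  simp only [width]
  omega

/-- The `r`-th child of node `i`. -/
def child (k s m : ℕ) (i : Fin (width k s m)) (r : Fin (2 * k + 1)) : Fin (width k s (m + 1)) :=
  ⟨s * (i : ℕ) + (r : ℕ), child_lt_width k s m i r⟩

/-- `IsAncestor k s m d i j`: node `i` of the layer that lies `m` layers below the output is an
ancestor of node `j` of the layer that lies another `d` layers below (`i = j` if `d = 0`). -/
def IsAncestor (k s m : ℕ) :
    (d : ℕ) → Fin (width k s m) → Fin (width k s (m + d)) → Prop
  | 0, i, j => i = j
  | d + 1, i, j => ∃ (l : Fin (width k s (m + d))) (r : Fin (2 * k + 1)),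
      IsAncestor k s m d i l ∧ j = child k s (m + d) l r

/-! ### The convolutional network -/

/-- A filter of size `2k+1`, as the Boolean function that it expresses. -/
abbrev BoolFilter (k : ℕ) : Type := (Fin (2 * k + 1) → Bool) → Bool

/-- The regular `(2k+1)`-majority. -/
def majority (k : ℕ) : BoolFilter k :=
  fun x => decide (k < (Finset.univ.filter fun r => x r = true).card)

/-- The weights `θ` have no ties: `∑ θ_r x_r ≠ 0` for every `x ∈ {±1}^(2k+1)`. -/
def NoTies {k : ℕ} (θ : Fin (2 * k + 1) → ℝ) : Prop :=
  ∀ x : Fin (2 * k + 1) → Bool, ∑ r, θ r * sgn (x r) ≠ 0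

/-- The Boolean function `x ↦ sign (∑ θ_r x_r)` expressed by weights `θ` without ties. -/
def weighted {k : ℕ} (θ : Fin (2 * k + 1) → ℝ) : BoolFilter k :=
  fun x => decide (0 < ∑ r, θ r * sgn (x r))

/-- One layer: the same filter is applied to the children of every node. -/
def convLayer (k s m : ℕ) (φ : BoolFilter k) (x : Fin (width k s (m + 1)) → Bool) :
    Fin (width k s m) → Bool :=
  fun i => φ fun r => x (child k s m i r)

/-- The Boolean function induced by the network of depth `n` in which the filter `φ t` computes
layer `t + 1` from layer `t`; layer `0` holds the input bits and layer `n` the output node. -/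
def network (k s : ℕ) : (n : ℕ) → (ℕ → BoolFilter k) → (Fin (width k s n) → Bool) → Bool
  | 0, _, x => x ⟨0, Nat.one_pos⟩
  | n + 1, φ, x => network k s n (fun t => φ (t + 1)) (convLayer k s n (φ 0) x)

/-- The convolutional iterated `(2k+1)`-majority function of depth `n` with stride `s`. -/
def iteratedMajority (k s n : ℕ) : (Fin (width k s n) → Bool) → Bool :=
  network k s n fun _ => majority k

end ConvMaj

end

/-!
In the Fourier expansion of an odd function, noise damps a character by the factor `1 - 2ε` once
for every coordinate, and at least once for every block of coordinates that the character meets.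
Fix a large `q`. Every window of `q` majority layers allows one to pass to a coarser partition of
the coordinates into blocks while the bound on the stability of the function under noise on whole
blocks shrinks by a fixed factor. Indeed, iterated majority erases a short stretch of disagreement
between two long constant runs, so a block with such runs on both sides is shielded from the
output; if every block is shielded with probability at least `δ`, then a definite part of the
Fourier weight lies on characters that meet more fine blocks than coarse ones.

The difficulty is that the window sits on top of arbitrary odd filters, so its input bits are only a
block factor of independent bits. Ramsey's theorem for tight paths bounds the probability of a long
constant run in such a factor from below, uniformly over all filters. With random filters,
independence makes the number of windows consisting of majority layers large.
-/

namespace ConvMaj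

open scoped BigOperators

/-! ### Walsh analysis on the discrete cube -/

theorem sgn_mul_self (b : Bool) : sgn b * sgn b = 1 := by cases b <;> simp [sgn]

theorem sgn_not (b : Bool) : sgn (!b) = -sgn b := by cases b <;> simp [sgn]

theorem sgn_xor (a b : Bool) : sgn (xor a b) = sgn a * -sgn b := by
  cases a <;> cases b <;> simp [sgn]

/-- The Walsh character `∏ i ∈ S, ω i` of the discrete cube. -/
noncomputable def walsh {ι : Type*} (S : Finset ι) (ω : ι → Bool) : ℝ := ∏ i ∈ S, sgn (ω i)

theorem walsh_xor {ι : Type*} (S : Finset ι) (ω η : ι → Bool) :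
    walsh S (fun i => xor (ω i) (η i)) = walsh S ω * ∏ i ∈ S, -sgn (η i) := by
  simp only [walsh, sgn_xor, Finset.prod_mul_distrib]

theorem walsh_mul_walsh {ι : Type*} [DecidableEq ι] (S T : Finset ι) (ω : ι → Bool) :
    walsh S ω * walsh T ω = walsh (symmDiff S T) ω := by
  have hsq : (∏ i ∈ S ∩ T, sgn (ω i)) * ∏ i ∈ S ∩ T, sgn (ω i) = 1 := by
    simp only [← Finset.prod_mul_distrib, sgn_mul_self, Finset.prod_const_one]
  have hS := Finset.prod_inter_mul_prod_sdiff S T fun i => sgn (ω i)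
  have hT := Finset.prod_inter_mul_prod_sdiff T S fun i => sgn (ω i)
  rw [Finset.inter_comm] at hT
  simp only [walsh, symmDiff_def, Finset.sup_eq_union]
  rw [Finset.prod_union disjoint_sdiff_sdiff, ← hS, ← hT, mul_mul_mul_comm, hsq, one_mul]

section Walsh

variable {ι : Type*} [Fintype ι] [DecidableEq ι]

theorem sum_walsh_mul_walsh (ω ω' : ι → Bool) :
    ∑ S, walsh S ω * walsh S ω' = if ω = ω' then (Fintype.card (ι → Bool) : ℝ) else 0 := by
  have hprod : ∑ S, walsh S ω * walsh S ω' = ∏ i, (1 + sgn (ω i) * sgn (ω' i)) := by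
    simp only [walsh, ← Finset.prod_mul_distrib, Finset.prod_one_add, Finset.powerset_univ]
  rw [hprod]
  split_ifs with heq
  · simp [heq, sgn_mul_self, one_add_one_eq_two]
  · obtain ⟨i, hi⟩ := Function.ne_iff.1 heq
    refine Finset.prod_eq_zero (Finset.mem_univ i) ?_
    rw [Bool.eq_not_of_ne hi, sgn_not, neg_mul, sgn_mul_self, add_neg_cancel]

/-- The Fourier–Walsh coefficient of `f` at `S`. -/
noncomputable def walshCoeff (f : (ι → Bool) → ℝ) (S : Finset ι) : ℝ := 𝔼 ω, f ω * walsh S ω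

theorem walshCoeff_empty (f : (ι → Bool) → ℝ) : walshCoeff f ∅ = 𝔼 ω, f ω := by
  simp [walshCoeff, walsh]

theorem sum_walshCoeff_mul_walsh (f : (ι → Bool) → ℝ) (ω : ι → Bool) :
    ∑ S, walshCoeff f S * walsh S ω = f ω := by
  simp only [walshCoeff, Finset.expect_mul, mul_assoc]
  rw [← Finset.expect_sum_comm]
  simp only [← Finset.mul_sum, sum_walsh_mul_walsh, Fintype.expect_eq_sum_div_card]
  simp

theorem expect_mul_eq_sum (f g : (ι → Bool) → ℝ) :
    𝔼 ω, f ω * g ω = ∑ S, walshCoeff f S * walshCoeff g S := by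
  calc 𝔼 ω, f ω * g ω
    _ = 𝔼 ω, ∑ S, walshCoeff f S * (g ω * walsh S ω) := by
      refine Finset.expect_congr rfl fun ω _ => ?_
      rw [← sum_walshCoeff_mul_walsh f ω, Finset.sum_mul]
      exact Finset.sum_congr rfl fun S _ => by ring
    _ = ∑ S, walshCoeff f S * walshCoeff g S := by
      simp only [Finset.expect_sum_comm, ← Finset.mul_expect, walshCoeff]

theorem sum_walshCoeff_sq (f : (ι → Bool) → ℝ) : ∑ S, walshCoeff f S ^ 2 = 𝔼 ω, f ω ^ 2 := by
  simp only [pow_two, expect_mul_eq_sum]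

theorem walshCoeff_mul (f g : (ι → Bool) → ℝ) (S : Finset ι) :
    walshCoeff (fun ω => f ω * g ω) S = ∑ V, walshCoeff f (symmDiff S V) * walshCoeff g V := by
  calc walshCoeff (fun ω => f ω * g ω) S
    _ = 𝔼 ω, f ω * walsh S ω * g ω := Finset.expect_congr rfl fun ω _ => by ring
    _ = ∑ V, walshCoeff (fun ω => f ω * walsh S ω) V * walshCoeff g V := expect_mul_eq_sum _ _
    _ = ∑ V, walshCoeff f (symmDiff S V) * walshCoeff g V := by
      simp only [walshCoeff, mul_assoc, walsh_mul_walsh]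

theorem walshCoeff_xor (f : (ι → Bool) → ℝ) (η : ι → Bool) (S : Finset ι) :
    walshCoeff (fun ω => f fun i => xor (ω i) (η i)) S = walshCoeff f S * ∏ i ∈ S, -sgn (η i) := by
  have hinv : Function.Involutive fun (ω : ι → Bool) i => xor (ω i) (η i) := fun ω => by simp
  rw [walshCoeff, walshCoeff, Finset.expect_mul]
  refine Fintype.expect_equiv hinv.toPerm _ _ fun ω => ?_
  have hη : ∏ i ∈ S, -sgn (η i) * -sgn (η i) = 1 := by simp [sgn_mul_self]
  rw [Finset.prod_mul_distrib] at hη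
  rw [Function.Involutive.coe_toPerm, walsh_xor, mul_assoc, mul_assoc, hη, mul_one]

theorem walshCoeff_eq_zero_of_dependsOn {f : (ι → Bool) → ℝ} {A : Set ι} (hf : DependsOn f A)
    {S : Finset ι} (hS : ¬ (S : Set ι) ⊆ A) : walshCoeff f S = 0 := by
  obtain ⟨i, hiS, hiA⟩ := Set.not_subset.1 hS
  have hinv : (fun ω => f fun j => xor (ω j) (decide (j = i))) = f := by
    refine funext fun ω => hf fun j hj => ?_
    simp [ne_of_mem_of_not_mem hj hiA]
  have hneg := walshCoeff_xor f (fun j => decide (j = i)) S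
  rw [hinv, Finset.prod_eq_single_of_mem i hiS fun j _ hji => by simp [hji, sgn]] at hneg
  simp only [decide_true, sgn, if_true] at hneg
  linarith

theorem walshCoeff_mul_of_dependsOn {c : (ι → Bool) → ℝ} (f : (ι → Bool) → ℝ) {S D : Finset ι}
    (hc : DependsOn c (D : Set ι)) (hSD : Disjoint S D) :
    walshCoeff (fun ω => c ω * f ω) S = (𝔼 ω, c ω) * walshCoeff f S +
      ∑ V with V \ D = S ∧ V ≠ S, walshCoeff c (symmDiff S V) * walshCoeff f V := by
  have hvanish : ∀ V, V \ D ≠ S → walshCoeff c (symmDiff S V) = 0 := fun V hV => by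
    refine walshCoeff_eq_zero_of_dependsOn hc fun hsub => hV ?_
    have hsub' : symmDiff S V ⊆ D := Finset.coe_subset.1 hsub
    grind [Finset.mem_symmDiff, Finset.disjoint_left]
  rw [walshCoeff_mul, ← Finset.add_sum_erase _ _ (Finset.mem_univ S), symmDiff_self,
    Finset.bot_eq_empty, walshCoeff_empty]
  congr 1
  refine (Finset.sum_subset_zero_on_sdiff (by grind) (fun V hV => ?_) fun _ _ => rfl).symm
  rw [hvanish V (by grind), zero_mul]

theorem expect_indicator_mul_walshCoeff_sq_le {f : (ι → Bool) → ℝ} {E : Set (ι → Bool)} {A : Set ι}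
    {D S : Finset ι} (hE : DependsOn (· ∈ E) (D : Set ι)) (hf : DependsOn (E.indicator f) A)
    (hSA : ¬ (S : Set ι) ⊆ A) (hSD : Disjoint S D) :
    (𝔼 ω, E.indicator 1 ω) * walshCoeff f S ^ 2 ≤
      ∑ V with V \ D = S ∧ V ≠ S, walshCoeff f V ^ 2 := by
  classical
  set c : (ι → Bool) → ℝ := E.indicator 1 with hc
  set p : ℝ := 𝔼 ω, c ω with hp
  have hcD : DependsOn c (D : Set ι) := fun x y hxy => by
    simp only [hc, Set.indicator_apply, hE hxy, Pi.one_apply]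
  have hcp : ∑ V, walshCoeff c (symmDiff S V) ^ 2 = p := by
    calc ∑ V, walshCoeff c (symmDiff S V) ^ 2
      _ = ∑ V, walshCoeff c V ^ 2 :=
        Equiv.sum_comp (symmDiff_right_involutive S).toPerm fun V => walshCoeff c V ^ 2
      _ = p := by simp [sum_walshCoeff_sq, hp, hc, Set.indicator_apply]
  have hcancel : p * walshCoeff f S +
      ∑ V with V \ D = S ∧ V ≠ S, walshCoeff c (symmDiff S V) * walshCoeff f V = 0 := by
    have hcf : (fun ω => c ω * f ω) = E.indicator f := by
      simp [hc, Set.indicator_apply, funext_iff]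
    rw [← walshCoeff_mul_of_dependsOn f hcD hSD, hcf, walshCoeff_eq_zero_of_dependsOn hf hSA]
  have hR : 0 ≤ ∑ V with V \ D = S ∧ V ≠ S, walshCoeff f V ^ 2 :=
    Finset.sum_nonneg fun _ _ => sq_nonneg _
  have hCS : p * (p * walshCoeff f S ^ 2) ≤ p * ∑ V with V \ D = S ∧ V ≠ S, walshCoeff f V ^ 2 := by
    calc p * (p * walshCoeff f S ^ 2)
      _ = (∑ V with V \ D = S ∧ V ≠ S, walshCoeff c (symmDiff S V) * walshCoeff f V) ^ 2 := by
        rw [eq_neg_of_add_eq_zero_right hcancel]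
        ring
      _ ≤ _ := Finset.sum_mul_sq_le_sq_mul_sq _ _ _
      _ ≤ _ := by
        refine mul_le_mul_of_nonneg_right ?_ hR
        rw [← hcp]
        exact Finset.sum_le_univ_sum_of_nonneg fun _ => sq_nonneg _
  have hp0 : 0 ≤ p := hcp ▸ Finset.sum_nonneg fun _ _ => sq_nonneg _
  rcases hp0.eq_or_lt with hp0 | hp0
  · rwa [← hp0, zero_mul]
  · exact le_of_mul_le_mul_left hCS hp0

end Walsh

/-! ### Contraction of the block stability under coarsening -/

section Blocks

variable {ι : Type*}

theorem card_image_comp_le (β : ι → ℕ) (ψ : ℕ → ℕ) (S : Finset ι) :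
    (S.image (ψ ∘ β)).card ≤ (S.image β).card := by
  rw [← Finset.image_image]
  exact Finset.card_image_le

/-- The first block that meets `S`; it serves as a representative block of `S`. -/
noncomputable def leadBlock (β : ι → ℕ) (S : Finset ι) : ℕ := sInf (β '' S)

theorem exists_eq_leadBlock (β : ι → ℕ) {S : Finset ι} (hS : S.Nonempty) :
    ∃ y ∈ S, β y = leadBlock β S :=
  Nat.sInf_mem (hS.to_set.image β)

theorem leadBlock_le (β : ι → ℕ) {S : Finset ι} {y : ι} (hy : y ∈ S) :
    leadBlock β S ≤ β y :=
  Nat.sInf_le (Set.mem_image_of_mem β hy)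

variable [Fintype ι]

/-- The coordinates that lie in the same coarse block (a fibre of `ψ ∘ β`) as block `i`, but not in
block `i` itself. -/
def siblings (β : ι → ℕ) (ψ : ℕ → ℕ) (i : ℕ) : Finset ι :=
  {y | ψ (β y) = ψ i ∧ β y ≠ i}

theorem mem_siblings {β : ι → ℕ} {ψ : ℕ → ℕ} {i : ℕ} {y : ι} :
    y ∈ siblings β ψ i ↔ ψ (β y) = ψ i ∧ β y ≠ i := by
  simp [siblings]

theorem card_image_comp_lt_of_not_disjoint {β : ι → ℕ} {ψ : ℕ → ℕ} {S : Finset ι}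
    (hS : ¬ Disjoint S (siblings β ψ (leadBlock β S))) :
    (S.image (ψ ∘ β)).card < (S.image β).card := by
  obtain ⟨z, hzS, hz⟩ := Finset.not_disjoint_iff.1 hS
  obtain ⟨y, hyS, hy⟩ := exists_eq_leadBlock β ⟨z, hzS⟩
  obtain ⟨hψz, hβz⟩ := mem_siblings.1 hz
  rw [← hy] at hψz hβz
  rw [← Finset.image_image]
  refine Finset.card_image_le.lt_of_ne fun hcard => hβz ?_
  exact Finset.card_image_iff.1 hcard (Finset.mem_coe.2 (Finset.mem_image_of_mem β hzS))
    (Finset.mem_coe.2 (Finset.mem_image_of_mem β hyS)) hψz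

variable [DecidableEq ι]

/-- The stability of `f`, without its mean, under noise that acts on each block `{y | β y = i}` as a
unit, so that a Walsh character meeting `j` blocks is damped by `l ^ j`. -/
noncomputable def blockStability (l : ℝ) (f : (ι → Bool) → ℝ) (β : ι → ℕ) : ℝ :=
  ∑ S : Finset ι with S.Nonempty, walshCoeff f S ^ 2 * l ^ (S.image β).card

/-- Block `i` is shielded if the siblings of block `i` determine an event of probability at least
`δ` on which `f` does not depend on block `i`. -/
def Shielded (f : (ι → Bool) → ℝ) (β : ι → ℕ) (ψ : ℕ → ℕ) (δ : ℝ) (i : ℕ) : Prop :=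
  ∃ E : Set (ι → Bool), DependsOn (· ∈ E) (siblings β ψ i : Set ι) ∧
    DependsOn (E.indicator f) {y | β y ≠ i} ∧ δ ≤ 𝔼 ω, E.indicator 1 ω

theorem blockStability_nonneg {l : ℝ} (hl : 0 ≤ l) (f : (ι → Bool) → ℝ) (β : ι → ℕ) :
    0 ≤ blockStability l f β :=
  Finset.sum_nonneg fun _ _ => by positivity

theorem blockStability_le_comp {l : ℝ} (hl : 0 ≤ l) (hl1 : l ≤ 1) (f : (ι → Bool) → ℝ)
    (β : ι → ℕ) (ψ : ℕ → ℕ) : blockStability l f β ≤ blockStability l f (ψ ∘ β) :=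
  Finset.sum_le_sum fun S _ => mul_le_mul_of_nonneg_left
    (pow_le_pow_of_le_one hl hl1 (card_image_comp_le β ψ S)) (sq_nonneg _)

theorem blockStability_comp_sub (l : ℝ) (f : (ι → Bool) → ℝ) (β : ι → ℕ) (ψ : ℕ → ℕ) :
    blockStability l f (ψ ∘ β) - blockStability l f β =
      ∑ S, walshCoeff f S ^ 2 * (l ^ (S.image (ψ ∘ β)).card - l ^ (S.image β).card) := by
  simp only [blockStability, ← Finset.sum_sub_distrib, ← mul_sub]
  refine Finset.sum_filter_of_ne fun S _ hS => Finset.nonempty_iff_ne_empty.2 ?_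
  rintro rfl
  simp at hS

section Extension

variable {β : ι → ℕ} {ψ : ℕ → ℕ} {S V : Finset ι}

theorem leadBlock_extension (hS : S.Nonempty) (hV : V \ siblings β ψ (leadBlock β S) = S) :
    ψ (leadBlock β V) = ψ (leadBlock β S) := by
  have hSV : S ⊆ V := hV ▸ Finset.sdiff_subset
  obtain ⟨y, hyS, hy⟩ := exists_eq_leadBlock β hS
  obtain ⟨z, hzV, hz⟩ := exists_eq_leadBlock β (hS.mono hSV)
  by_cases hzS : z ∈ S
  · have hle : leadBlock β V ≤ leadBlock β S := hy ▸ leadBlock_le β (hSV hyS)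
    have hge : leadBlock β S ≤ leadBlock β V := hz ▸ leadBlock_le β hzS
    rw [hle.antisymm hge]
  · have hzsib : z ∈ siblings β ψ (leadBlock β S) := by grind
    rw [← hz, (mem_siblings.1 hzsib).1]

theorem card_image_comp_extension_le (hS : S.Nonempty)
    (hV : V \ siblings β ψ (leadBlock β S) = S) :
    (V.image (ψ ∘ β)).card ≤ (S.image β).card := by
  refine le_trans (Finset.card_le_card ?_) (card_image_comp_le β ψ S)
  obtain ⟨y, hyS, hy⟩ := exists_eq_leadBlock β hS
  refine Finset.image_subset_iff.2 fun z hzV => ?_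
  by_cases hzS : z ∈ S
  · exact Finset.mem_image_of_mem _ hzS
  · have hzsib : z ∈ siblings β ψ (leadBlock β S) := by grind
    refine Finset.mem_image.2 ⟨y, hyS, ?_⟩
    rw [Function.comp_apply, Function.comp_apply, (mem_siblings.1 hzsib).1, hy]

theorem card_image_lt_extension (hV : V \ siblings β ψ (leadBlock β S) = S) (hne : V ≠ S) :
    (S.image β).card < (V.image β).card := by
  have hSV : S ⊆ V := hV ▸ Finset.sdiff_subset
  obtain ⟨z, hzV, hzS⟩ := Finset.exists_of_ssubset (hSV.ssubset_of_ne hne.symm)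
  have hz : z ∈ siblings β ψ (leadBlock β S) := by grind
  refine Finset.card_lt_card (Finset.ssubset_iff_of_subset (Finset.image_subset_image hSV) |>.2
    ⟨β z, Finset.mem_image_of_mem β hzV, fun hmem => ?_⟩)
  obtain ⟨w, hwS, hwz⟩ := Finset.mem_image.1 hmem
  rw [← hV, Finset.mem_sdiff, mem_siblings, hwz, ← mem_siblings] at hwS
  exact hwS.2 hz

theorem card_extended_le {M : ℕ} (hM : ∀ i, (ψ ⁻¹' {i}).encard ≤ M) (V : Finset ι) :
    (Finset.card {S : Finset ι | S.Nonempty ∧ V \ siblings β ψ (leadBlock β S) = S}) ≤ M := by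
  rw [← Nat.cast_le (α := ℕ∞), ← Set.encard_coe_eq_coe_finsetCard]
  refine (Set.encard_le_encard ?_).trans
    ((Set.encard_image_le (fun i => V \ siblings β ψ i) _).trans (hM (ψ (leadBlock β V))))
  intro S hS
  obtain ⟨hSne, hV⟩ := (Finset.mem_filter.1 (Finset.mem_coe.1 hS)).2
  exact ⟨leadBlock β S, (leadBlock_extension hSne hV).symm, hV⟩

end Extension

section Gain

theorem one_sub_mul_pow_le {l : ℝ} (hl : 0 ≤ l) (hl1 : l ≤ 1) {a m b : ℕ} (ham : a ≤ m)
    (hmb : m < b) : (1 - l) * l ^ m ≤ l ^ a - l ^ b := by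
  have ha := pow_le_pow_of_le_one hl hl1 ham
  have hb := pow_le_pow_of_le_one hl hl1 (Nat.succ_le_of_lt hmb)
  rw [pow_succ] at hb
  linarith

variable {l δ : ℝ} {f : (ι → Bool) → ℝ} {β : ι → ℕ} {ψ : ℕ → ℕ} {S : Finset ι}

theorem Shielded.mul_sq_le_sum_extension (h : Shielded f β ψ δ (leadBlock β S)) (hS : S.Nonempty)
    (hdisj : Disjoint S (siblings β ψ (leadBlock β S))) :
    δ * walshCoeff f S ^ 2 ≤
      ∑ V with V \ siblings β ψ (leadBlock β S) = S ∧ V ≠ S, walshCoeff f V ^ 2 := by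
  obtain ⟨E, hE, hf, hδ⟩ := h
  obtain ⟨y, hyS, hy⟩ := exists_eq_leadBlock β hS
  exact (mul_le_mul_of_nonneg_right hδ (sq_nonneg _)).trans
    (expect_indicator_mul_walshCoeff_sq_le hE hf (fun hsub => hsub hyS hy) hdisj)

theorem Shielded.mul_le_gain (h : Shielded f β ψ δ (leadBlock β S)) (hl : 0 ≤ l) (hl1 : l ≤ 1)
    (hδ1 : δ ≤ 1) (hS : S.Nonempty) :
    δ * (1 - l) * (walshCoeff f S ^ 2 * l ^ (S.image β).card) ≤
      walshCoeff f S ^ 2 * (l ^ (S.image (ψ ∘ β)).card - l ^ (S.image β).card) +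
      ∑ V with V \ siblings β ψ (leadBlock β S) = S ∧ V ≠ S,
        walshCoeff f V ^ 2 * (l ^ (V.image (ψ ∘ β)).card - l ^ (V.image β).card) := by
  have hgain : ∀ V : Finset ι,
      0 ≤ walshCoeff f V ^ 2 * (l ^ (V.image (ψ ∘ β)).card - l ^ (V.image β).card) := fun V =>
    mul_nonneg (sq_nonneg _)
      (sub_nonneg.2 (pow_le_pow_of_le_one hl hl1 (card_image_comp_le β ψ V)))
  have hpow : 0 ≤ (1 - l) * l ^ (S.image β).card :=
    mul_nonneg (sub_nonneg.2 hl1) (pow_nonneg hl _)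
  by_cases hdisj : Disjoint S (siblings β ψ (leadBlock β S))
  · refine le_add_of_nonneg_of_le (hgain S) ?_
    calc δ * (1 - l) * (walshCoeff f S ^ 2 * l ^ (S.image β).card)
      _ = δ * walshCoeff f S ^ 2 * ((1 - l) * l ^ (S.image β).card) := by ring
      _ ≤ (∑ V with V \ siblings β ψ (leadBlock β S) = S ∧ V ≠ S, walshCoeff f V ^ 2) *
          ((1 - l) * l ^ (S.image β).card) :=
        mul_le_mul_of_nonneg_right (h.mul_sq_le_sum_extension hS hdisj) hpow
      _ ≤ _ := by
        rw [Finset.sum_mul]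
        refine Finset.sum_le_sum fun V hV => mul_le_mul_of_nonneg_left ?_ (sq_nonneg _)
        obtain ⟨hVS, hne⟩ := (Finset.mem_filter.1 hV).2
        exact one_sub_mul_pow_le hl hl1 (card_image_comp_extension_le hS hVS)
          (card_image_lt_extension hVS hne)
  · refine le_add_of_le_of_nonneg ?_ (Finset.sum_nonneg fun V _ => hgain V)
    calc δ * (1 - l) * (walshCoeff f S ^ 2 * l ^ (S.image β).card)
      _ = δ * (walshCoeff f S ^ 2 * ((1 - l) * l ^ (S.image β).card)) := by ring
      _ ≤ walshCoeff f S ^ 2 * ((1 - l) * l ^ (S.image β).card) :=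
        mul_le_of_le_one_left (mul_nonneg (sq_nonneg _) hpow) hδ1
      _ ≤ walshCoeff f S ^ 2 * ((1 - l) * l ^ (S.image (ψ ∘ β)).card) := by
        have := sub_nonneg.2 hl1
        have := pow_le_pow_of_le_one hl hl1 (card_image_comp_le β ψ S)
        gcongr
      _ ≤ _ := mul_le_mul_of_nonneg_left
        (one_sub_mul_pow_le hl hl1 le_rfl (card_image_comp_lt_of_not_disjoint hdisj)) (sq_nonneg _)

open Classical in
theorem sum_shielded_le {M : ℕ} (hl : 0 ≤ l) (hl1 : l ≤ 1) (hδ1 : δ ≤ 1)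
    (f : (ι → Bool) → ℝ) (β : ι → ℕ) (hM : ∀ i, (ψ ⁻¹' {i}).encard ≤ M) :
    δ * (1 - l) * ∑ S : Finset ι with S.Nonempty ∧ Shielded f β ψ δ (leadBlock β S),
        walshCoeff f S ^ 2 * l ^ (S.image β).card ≤
      (M + 1) * (blockStability l f (ψ ∘ β) - blockStability l f β) := by
  set gain : Finset ι → ℝ := fun V =>
    walshCoeff f V ^ 2 * (l ^ (V.image (ψ ∘ β)).card - l ^ (V.image β).card)
  have hgain0 : ∀ V, 0 ≤ gain V := fun V => mul_nonneg (sq_nonneg _)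
    (sub_nonneg.2 (pow_le_pow_of_le_one hl hl1 (card_image_comp_le β ψ V)))
  set G : Finset (Finset ι) := {S | S.Nonempty ∧ Shielded f β ψ δ (leadBlock β S)} with hG
  have hextensions : ∑ S ∈ G, ∑ V with V \ siblings β ψ (leadBlock β S) = S ∧ V ≠ S, gain V ≤
      M * ∑ V, gain V := by
    calc ∑ S ∈ G, ∑ V with V \ siblings β ψ (leadBlock β S) = S ∧ V ≠ S, gain V
      _ = ∑ V, ∑ S ∈ G with V \ siblings β ψ (leadBlock β S) = S ∧ V ≠ S, gain V :=
        Finset.sum_comm' fun S V => by simp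
      _ ≤ ∑ V, M * gain V := Finset.sum_le_sum fun V _ => by
        rw [Finset.sum_const, nsmul_eq_mul]
        refine mul_le_mul_of_nonneg_right (Nat.cast_le.2 ?_) (hgain0 V)
        refine (Finset.card_le_card fun S hS => ?_).trans (card_extended_le (β := β) hM V)
        simp only [hG, Finset.mem_filter, Finset.mem_univ, true_and] at hS ⊢
        exact ⟨hS.1.1, hS.2.1⟩
      _ = M * ∑ V, gain V := (Finset.mul_sum _ _ _).symm
  calc δ * (1 - l) * ∑ S ∈ G, walshCoeff f S ^ 2 * l ^ (S.image β).card
    _ ≤ ∑ S ∈ G, (gain S +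
        ∑ V with V \ siblings β ψ (leadBlock β S) = S ∧ V ≠ S, gain V) := by
      rw [Finset.mul_sum]
      refine Finset.sum_le_sum fun S hS => ?_
      obtain ⟨hSne, hShield⟩ := (Finset.mem_filter.1 hS).2
      exact hShield.mul_le_gain hl hl1 hδ1 hSne
    _ ≤ ∑ V, gain V + M * ∑ V, gain V := by
      rw [Finset.sum_add_distrib]
      exact add_le_add (Finset.sum_le_univ_sum_of_nonneg hgain0) hextensions
    _ = (M + 1) * (blockStability l f (ψ ∘ β) - blockStability l f β) := by
      rw [blockStability_comp_sub]
      ring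

end Gain

theorem exists_blockStability_le {l δ : ℝ} (hl : 0 ≤ l) (hl1 : l ≤ 1) (hδ : 0 ≤ δ) (hδ1 : δ ≤ 1)
    (f : (ι → Bool) → ℝ) (β : ι → ℕ) (ψ : Bool → ℕ → ℕ) {M : ℕ}
    (hM : ∀ b i, (ψ b ⁻¹' {i}).encard ≤ M) (hψ : ∀ y, ∃ b, Shielded f β (ψ b) δ (β y)) :
    ∃ b, blockStability l f β ≤
      (1 + δ * (1 - l) / (2 * (M + 1)))⁻¹ * blockStability l f (ψ b ∘ β) := by
  classical
  set weight : Finset ι → ℝ := fun S => walshCoeff f S ^ 2 * l ^ (S.image β).card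
  have hcover : blockStability l f β ≤ ∑ b, ∑ S : Finset ι with
      S.Nonempty ∧ Shielded f β (ψ b) δ (leadBlock β S), weight S := by
    simp only [← Finset.filter_filter, Finset.sum_filter (Shielded f β _ δ <| leadBlock β ·)]
    rw [Finset.sum_comm]
    refine Finset.sum_le_sum fun S hS => ?_
    obtain ⟨y, -, hy⟩ := exists_eq_leadBlock β (Finset.mem_filter.1 hS).2
    obtain ⟨b, hb⟩ := hψ y
    have hweight0 : 0 ≤ weight S := by positivity
    refine le_trans (if_pos (hy ▸ hb)).ge
      (Finset.single_le_sum (f := fun b => if Shielded f β (ψ b) δ (leadBlock β S) then weight S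
        else 0) (fun _ _ => ?_) (Finset.mem_univ b))
    split_ifs <;> simp [hweight0]
  have hhalves : ∑ _b : Bool, blockStability l f β / 2 = blockStability l f β := by
    rw [Fintype.sum_bool, add_halves]
  obtain ⟨b, -, hb⟩ := Finset.exists_le_of_sum_le Finset.univ_nonempty (hhalves.trans_le hcover)
  refine ⟨b, ?_⟩
  have hgain := (mul_le_mul_of_nonneg_left hb (mul_nonneg hδ (sub_nonneg.2 hl1))).trans
    (sum_shielded_le hl hl1 hδ1 f β (hM b))
  have hpos : 0 < 1 + δ * (1 - l) / (2 * (M + 1)) := by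
    have := sub_nonneg.2 hl1
    positivity
  rw [inv_mul_eq_div, le_div_iff₀ hpos, mul_add, mul_one, mul_div_assoc', ← le_sub_iff_add_le',
    div_le_iff₀ (by positivity)]
  linarith

end Blocks

/-! ### The network on an infinite sequence of nodes -/

/-- One convolutional layer on an infinite sequence of nodes. -/
def layerStep {k : ℕ} (s : ℕ) (φ : BoolFilter k) (x : ℕ → Bool) (j : ℕ) : Bool :=
  φ fun r => x (s * j + r)

/-- Layer `t` of the network on an infinite sequence `x` of inputs, without cutting the layers down
to finite width: `layer s φ t x j` is the value of node `j`. -/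
def layer {k : ℕ} (s : ℕ) (φ : ℕ → BoolFilter k) : ℕ → (ℕ → Bool) → ℕ → Bool
  | 0, x => x
  | t + 1, x => layerStep s (φ t) (layer s φ t x)

/-- A finite sequence of bits, extended by `true`. -/
def extend {N : ℕ} (ω : Fin N → Bool) (i : ℕ) : Bool := if h : i < N then ω ⟨i, h⟩ else true

theorem extend_apply {N : ℕ} (ω : Fin N → Bool) {i : ℕ} (hi : i < N) : extend ω i = ω ⟨i, hi⟩ :=
  dif_pos hi

section Layer

variable {k s : ℕ}

theorem layerStep_congr (φ : BoolFilter k) {x y : ℕ → Bool} {i j : ℕ}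
    (h : ∀ r ≤ 2 * k, x (s * i + r) = y (s * j + r)) : layerStep s φ x i = layerStep s φ y j :=
  congrArg φ (funext fun r => h r (Nat.lt_succ_iff.1 r.isLt))

theorem layer_add (φ : ℕ → BoolFilter k) (a b : ℕ) (x : ℕ → Bool) :
    layer s φ (a + b) x = layer s (fun t => φ (a + t)) b (layer s φ a x) := by
  induction b with
  | zero => rfl
  | succ b ih => exact congrArg (layerStep s (φ (a + b))) ih

theorem layer_succ (φ : ℕ → BoolFilter k) (t : ℕ) (x : ℕ → Bool) :
    layer s φ (t + 1) x = layer s (fun t => φ (t + 1)) t (layerStep s (φ 0) x) := by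
  rw [add_comm, layer_add]
  simp only [add_comm 1, layer]

/-- The receptive field of node `j` of layer `t` starts at `s ^ t * j`, and the value of the node is
a function of its receptive field that does not depend on `j`. -/
theorem layer_congr (hs : 2 ≤ s) (φ : ℕ → BoolFilter k) {x y : ℕ → Bool} {t i j : ℕ}
    (h : ∀ v < (2 * k + 1) * s ^ t, x (s ^ t * i + v) = y (s ^ t * j + v)) :
    layer s φ t x i = layer s φ t y j := by
  induction t generalizing i j with
  | zero => simpa [layer] using h 0 (by simp)
  | succ t ih =>
    refine layerStep_congr _ fun r hr => ih fun v hv => ?_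
    have hfield : s ^ t * r + v < (2 * k + 1) * s ^ (t + 1) := by
      calc s ^ t * r + v < s ^ t * (2 * k) + (2 * k + 1) * s ^ t :=
            add_lt_add_of_le_of_lt (Nat.mul_le_mul_left _ hr) hv
        _ = s ^ t * (4 * k + 1) := by ring
        _ ≤ s ^ t * ((2 * k + 1) * s) := Nat.mul_le_mul_left _ (by nlinarith)
        _ = (2 * k + 1) * s ^ (t + 1) := by ring
    have hsplit : ∀ i, s ^ (t + 1) * i + (s ^ t * r + v) = s ^ t * (s * i + r) + v := fun i => by
      ring
    simpa only [hsplit] using h _ hfield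

theorem width_pos (k s m : ℕ) : 0 < width k s m := by
  cases m <;> simp [width]

theorem mul_add_lt_width {m j r : ℕ} (hj : j < width k s m) (hr : r ≤ 2 * k) :
    s * j + r < width k s (m + 1) :=
  child_lt_width k s m ⟨j, hj⟩ ⟨r, Nat.lt_succ_iff.2 hr⟩

theorem layer_congr_width (φ : ℕ → BoolFilter k) {x y : ℕ → Bool} {m t j : ℕ}
    (h : ∀ i < width k s (m + t), x i = y i) (hj : j < width k s m) :
    layer s φ t x j = layer s φ t y j := by
  induction t generalizing m j with
  | zero => exact h j hj
  | succ t ih =>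
    refine layerStep_congr _ fun r hr =>
      ih (m := m + 1) (fun i hi => h i ?_) (mul_add_lt_width hj hr)
    rwa [← add_assoc, add_right_comm]

theorem extend_convLayer (m : ℕ) (φ : BoolFilter k) (ω : Fin (width k s (m + 1)) → Bool) {i : ℕ}
    (hi : i < width k s m) : extend (convLayer k s m φ ω) i = layerStep s φ (extend ω) i := by
  rw [extend_apply _ hi]
  refine congrArg φ (funext fun r => ?_)
  rw [extend_apply _ (mul_add_lt_width hi (Nat.lt_succ_iff.1 r.isLt))]
  rfl

theorem network_eq_layer (n : ℕ) (φ : ℕ → BoolFilter k) (ω : Fin (width k s n) → Bool) :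
    network k s n φ ω = layer s φ n (extend ω) 0 := by
  induction n generalizing φ with
  | zero => simp [network, layer, extend, width]
  | succ n ih =>
    rw [network, ih, layer_succ]
    refine layer_congr_width (m := 0) _ (fun i hi => extend_convLayer n _ ω ?_) (width_pos k s 0)
    rwa [zero_add] at hi

end Layer

/-! ### Odd Boolean functions -/

/-- A Boolean function is odd if it commutes with the negation of all bits. -/
def IsOdd {ι : Type*} (f : (ι → Bool) → Bool) : Prop := ∀ x, f (fun i => !x i) = !f x

section Odd

variable {k s : ℕ}

theorem IsOdd.layer {φ : ℕ → BoolFilter k} {t : ℕ} (hφ : ∀ a < t, IsOdd (φ a)) (j : ℕ) :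
    IsOdd fun x => layer s φ t x j := fun x => by
  induction t generalizing j with
  | zero => rfl
  | succ t ih =>
    refine Eq.trans ?_ (hφ t t.lt_succ_self _)
    exact congrArg (φ t) (funext fun r => ih (fun a ha => hφ a (ha.trans t.lt_succ_self)) _)

theorem IsOdd.network {φ : ℕ → BoolFilter k} {n : ℕ} (hφ : ∀ a < n, IsOdd (φ a)) :
    IsOdd (network k s n φ) := by
  induction n generalizing φ with
  | zero => exact fun _ => rfl
  | succ n ih =>
    intro x
    rw [ConvMaj.network, ConvMaj.network, ← ih fun a ha => hφ (a + 1) (Nat.succ_lt_succ ha)]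
    exact congrArg _ (funext fun i => hφ 0 n.succ_pos _)

theorem isOdd_majority (k : ℕ) : IsOdd (majority k) := by
  intro x
  have hcard := Finset.card_filter_add_card_filter_not (s := Finset.univ) (fun r => x r = true)
  simp only [Finset.card_univ, Fintype.card_fin, Bool.not_eq_true] at hcard
  simp only [majority, Bool.not_eq_true']
  rw [← decide_not, decide_eq_decide]
  omega

theorem isOdd_weighted {θ : Fin (2 * k + 1) → ℝ} (hθ : NoTies θ) : IsOdd (weighted θ) := by
  intro x
  simp only [weighted, sgn_not, mul_neg, Finset.sum_neg_distrib]
  rw [← decide_not, decide_eq_decide, not_lt, Left.neg_pos_iff]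
  exact ⟨le_of_lt, fun hle => hle.lt_of_ne (hθ x)⟩

end Odd

/-! ### Iterated majority corrects short disagreements between long runs -/

section Majority

variable {k s : ℕ}

theorem majority_eq_true {x : Fin (2 * k + 1) → Bool} {T : Finset (Fin (2 * k + 1))}
    (hT : k < T.card) (h : ∀ r ∈ T, x r = true) : majority k x = true := by
  rw [majority, decide_eq_true_eq]
  exact hT.trans_le (Finset.card_le_card fun r hr => by simp [h r hr])

theorem majority_eq_true_of_run {x : Fin (2 * k + 1) → Bool} {c : ℕ} (hc : c ≤ k)
    (h : ∀ r : Fin (2 * k + 1), c ≤ r → (r : ℕ) ≤ c + k → x r = true) : majority k x = true := by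
  refine majority_eq_true (T := Finset.Icc ⟨c, by omega⟩ ⟨c + k, by omega⟩) ?_ fun r hr => ?_
  · simp only [Fin.card_Icc]
    omega
  · obtain ⟨hcr, hrc⟩ := Finset.mem_Icc.1 hr
    exact h r hcr hrc

/-- `x` and `y` agree outside `[a, b)`, and are `true` on the two windows of length `R` that are
adjacent to `[a, b)`. -/
structure AgreeOff (a b R : ℕ) (x y : ℕ → Bool) : Prop where
  eq_of_lt_or_le : ∀ i, i < a ∨ b ≤ i → x i = y i
  left_eq_true : ∀ i, i < a → a ≤ i + R → x i = true
  right_eq_true : ∀ i, b ≤ i → i < b + R → x i = true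

namespace AgreeOff

variable {a b R : ℕ} {x y : ℕ → Bool}

theorem symm (h : AgreeOff a b R x y) : AgreeOff a b R y x where
  eq_of_lt_or_le i hi := (h.eq_of_lt_or_le i hi).symm
  left_eq_true i hi hi' := h.eq_of_lt_or_le i (Or.inl hi) ▸ h.left_eq_true i hi hi'
  right_eq_true i hi hi' := h.eq_of_lt_or_le i (Or.inr hi) ▸ h.right_eq_true i hi hi'

theorem layerStep_left_eq_true (h : AgreeOff a b R x y) {j : ℕ} (hj : s * j + k < a)
    (hR : a ≤ s * j + R) : layerStep s (majority k) x j = true :=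
  majority_eq_true_of_run (c := 0) k.zero_le fun r _ hr =>
    h.left_eq_true _ (by omega) (by omega)

theorem layerStep_right_eq_true (h : AgreeOff a b R x y) {j : ℕ} (hj : b ≤ s * j + k)
    (hR : s * j + 2 * k < b + R) : layerStep s (majority k) x j = true :=
  majority_eq_true_of_run (c := k) le_rfl fun r hr _ =>
    h.right_eq_true _ (by omega) (by omega)

theorem layerStep_left_eq (h : AgreeOff a b R x y) (hR : 2 * k + 1 ≤ R) {j : ℕ}
    (hj : s * j + k < a) : layerStep s (majority k) x j = layerStep s (majority k) y j := by
  by_cases hja : s * j + 2 * k < a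
  · exact layerStep_congr _ fun r hr => h.eq_of_lt_or_le _ (Or.inl (by omega))
  · rw [h.layerStep_left_eq_true hj (by omega), h.symm.layerStep_left_eq_true hj (by omega)]

theorem layerStep_right_eq (h : AgreeOff a b R x y) (hR : 2 * k + 1 ≤ R) {j : ℕ}
    (hj : b ≤ s * j + k) : layerStep s (majority k) x j = layerStep s (majority k) y j := by
  by_cases hjb : b ≤ s * j
  · exact layerStep_congr _ fun r _ => h.eq_of_lt_or_le _ (Or.inr (by omega))
  · rw [h.layerStep_right_eq_true hj (by omega), h.symm.layerStep_right_eq_true hj (by omega)]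

theorem layerStep {a' b' : ℕ} (h : AgreeOff a b (2 * k + 1 + s * R) x y)
    (ha : ∀ j, j < a' ↔ s * j + k < a) (hb : ∀ j, j < b' ↔ s * j + k < b) :
    AgreeOff a' b' R (layerStep s (majority k) x) (layerStep s (majority k) y) where
  eq_of_lt_or_le j hj := by
    rcases hj with hj | hj
    · exact h.layerStep_left_eq (Nat.le_add_right _ _) ((ha j).1 hj)
    · exact h.layerStep_right_eq (Nat.le_add_right _ _) (not_lt.1 ((hb j).not.1 hj.not_gt))
  left_eq_true j hj hj' := by
    have hle := (ha (j + R)).not.1 hj'.not_gt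
    rw [mul_add] at hle
    exact h.layerStep_left_eq_true ((ha j).1 hj) (by omega)
  right_eq_true j hj hj' := by
    refine h.layerStep_right_eq_true (not_lt.1 ((hb j).not.1 hj.not_gt)) ?_
    rcases Nat.eq_zero_or_pos b' with hb0 | hb0
    · have := Nat.mul_le_mul_left s (show j ≤ R by omega)
      omega
    · have hlast := (hb (b' - 1)).1 (by omega)
      have hmul := Nat.mul_le_mul_left s (show j ≤ (b' - 1) + R by omega)
      rw [mul_add] at hmul
      omega

theorem layerStep_eq (hk : 1 ≤ k) (h : AgreeOff a b R x y) (hab : a ≤ b) (hba : b ≤ a + 1)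
    (hR : 2 * k + 1 ≤ R) :
    ConvMaj.layerStep s (majority k) x = ConvMaj.layerStep s (majority k) y := by
  have htrue : ∀ z w : ℕ → Bool, AgreeOff a b R z w → ∀ j, s * j ≤ a → a ≤ s * j + 2 * k →
      ConvMaj.layerStep s (majority k) z j = true := fun z w hz j hja haj => by
    refine majority_eq_true (T := Finset.univ.erase ⟨a - s * j, by omega⟩) ?_ fun r hr => ?_
    · rw [Finset.card_erase_of_mem (Finset.mem_univ _), Finset.card_univ, Fintype.card_fin]
      omega
    · have hne : (r : ℕ) ≠ a - s * j := Fin.val_ne_of_ne (Finset.ne_of_mem_erase hr)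
      rcases lt_or_ge (s * j + r) a with hlt | hge
      · exact hz.left_eq_true _ hlt (by omega)
      · exact hz.right_eq_true _ (by omega) (by omega)
  ext j
  by_cases hj : s * j ≤ a ∧ a ≤ s * j + 2 * k
  · rw [htrue x y h j hj.1 hj.2, htrue y x h.symm j hj.1 hj.2]
  · exact layerStep_congr _ fun r hr => h.eq_of_lt_or_le _ (by omega)

end AgreeOff

/-- A length of the runs of `true` that protect an interval of length `s ^ p` through `p` majority
layers. -/
def radius (k s : ℕ) : ℕ → ℕ
  | 0 => 2 * k + 1
  | p + 1 => 2 * k + 1 + s * radius k s p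

theorem lt_ceilDiv_iff (hs : 0 < s) (a k j : ℕ) :
    j < (a - k + (s - 1)) / s ↔ s * j + k < a := by
  rw [Nat.lt_iff_add_one_le, Nat.le_div_iff_mul_le hs, add_mul, mul_comm j s]
  omega

theorem AgreeOff.layer_eq (hk : 1 ≤ k) (hs : 2 ≤ s) {p a b : ℕ} {x y : ℕ → Bool}
    {φ : ℕ → BoolFilter k} (hφ : ∀ t ≤ p, φ t = majority k) (h : AgreeOff a b (radius k s p) x y)
    (hab : a ≤ b) (hba : b ≤ a + s ^ p) : layer s φ (p + 1) x = layer s φ (p + 1) y := by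
  induction p generalizing a b x y φ with
  | zero =>
    simp only [layer, hφ 0 le_rfl]
    exact h.layerStep_eq hk hab (by simpa using hba) le_rfl
  | succ p ih =>
    have ha := lt_ceilDiv_iff (s := s) (by omega) a k
    have hb := lt_ceilDiv_iff (s := s) (by omega) b k
    set a' := (a - k + (s - 1)) / s
    set b' := (b - k + (s - 1)) / s
    rw [layer_succ, layer_succ _ _ y, hφ 0 p.succ.zero_le]
    refine ih (a := a') (b := b') (fun t ht => hφ (t + 1) (by omega)) (h.layerStep ha hb) ?_ ?_
    · exact le_of_not_gt fun hlt => (hb b').not.1 (lt_irrefl _) (((ha b').1 hlt).trans_le hab)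
    · refine le_of_not_gt fun hlt => (ha a').not.1 (lt_irrefl _) ?_
      have hlt' := (hb (a' + s ^ p)).1 hlt
      rw [mul_add, ← pow_succ'] at hlt'
      omega

end Majority

/-! ### Monochromatic runs in block factors of independent sequences -/

/-- `a 0 < a 1 < ⋯ < a (W + r - 1)` are numbers below `N` whose `W` consecutive `(r+1)`-tuples all
have the colour `c`; in hypergraph terms, a monochromatic tight path. -/
structure IsTightPath {C : Type*} {r : ℕ} (χ : (Fin (r + 1) → ℕ) → C) (N : ℕ) (c : C) (W : ℕ)
    (a : ℕ → ℕ) : Prop where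
  lt_succ : ∀ i, i + 1 < W + r → a i < a (i + 1)
  lt_bound : ∀ i < W + r, a i < N
  color_eq : ∀ i < W, χ (fun v => a (i + v)) = c

namespace IsTightPath

variable {C : Type*} {r : ℕ}

theorem injOn {χ : (Fin (r + 1) → ℕ) → C} {N W : ℕ} {c : C} {a : ℕ → ℕ}
    (h : IsTightPath χ N c W a) : Set.InjOn a (Set.Iio (W + r)) :=
  (strictMonoOn_of_lt_add_one Set.ordConnected_Iio fun i _ _ hi => h.lt_succ i hi).injOn

theorem exists_extend {χ : (Fin (r + 2) → ℕ) → C} {N W : ℕ} {c : C} {a b : ℕ → ℕ}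
    (hb : IsTightPath χ N c W b) (hba : ∀ v ≤ r, b (W + v) = a v) (ha : a r < a (r + 1))
    (haN : a (r + 1) < N) (hac : χ (fun v => a v) = c) :
    ∃ b', IsTightPath χ N c (W + 1) b' ∧ ∀ v ≤ r, b' (W + 1 + v) = a (v + 1) := by
  set b' : ℕ → ℕ := fun i => if i ≤ W + r then b i else a (i - W) with hb'
  have hleft : ∀ i ≤ W + r, b' i = b i := fun i hi => if_pos hi
  have hright : ∀ v, b' (W + v) = a v := fun v => by
    by_cases hv : v ≤ r
    · rw [hleft _ (by omega), hba v hv]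
    · simp only [hb', if_neg (show ¬ W + v ≤ W + r by omega), Nat.add_sub_cancel_left]
  refine ⟨b', ⟨fun i hi => ?_, fun i hi => ?_, fun i hi => ?_⟩, fun v _ => ?_⟩
  · rcases (show i + 1 ≤ W + r ∨ i = W + r by omega) with hi | rfl
    · rw [hleft i (by omega), hleft _ hi]
      exact hb.lt_succ i (by omega)
    · rw [add_assoc, hright, hright]
      exact ha
  · rcases (show i ≤ W + r ∨ i = W + (r + 1) by omega) with hi | rfl
    · rw [hleft i hi]
      exact hb.lt_bound i (by omega)
    · rw [hright]
      exact haN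
  · rcases Nat.lt_succ_iff_lt_or_eq.1 hi with hi | rfl
    · rw [← hb.color_eq i hi]
      exact congrArg χ (funext fun v => hleft _ (by omega))
    · rw [← hac]
      exact congrArg χ (funext fun v => hright v)
  · rw [add_assoc, add_comm 1, hright]

end IsTightPath

open Classical in
theorem exists_isTightPath_singletons (C : Type*) [Finite C] (W : ℕ) : ∃ N : ℕ,
    ∀ χ : (Fin 1 → ℕ) → C, ∃ c a, IsTightPath χ N c W a := by
  have := Fintype.ofFinite C
  refine ⟨Fintype.card C * W + 1, fun χ => ?_⟩
  obtain ⟨c, -, hc⟩ := Finset.exists_lt_card_fiber_of_mul_lt_card_of_maps_to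
    (s := Finset.range (Fintype.card C * W + 1)) (t := Finset.univ) (n := W)
    (f := fun v => χ fun _ => v) (fun _ _ => Finset.mem_univ _) (by simp)
  set T := {v ∈ Finset.range (Fintype.card C * W + 1) | χ (fun _ => v) = c}
  have hfin : {v | v ∈ T}.Finite := T.finite_toSet
  have hcard : hfin.toFinset.card = T.card := congrArg Finset.card (by ext v; simp)
  have hmem : ∀ i < W, Nat.nth (· ∈ T) i ∈ T := fun i hi =>
    Nat.nth_mem_of_lt_card hfin (by omega)
  refine ⟨c, Nat.nth (· ∈ T), fun i hi => ?_, fun i hi => ?_, fun i hi => ?_⟩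
  · exact Nat.nth_lt_nth_of_lt_card hfin i.lt_succ_self (by omega)
  · exact Finset.mem_range.1 (Finset.mem_filter.1 (hmem i hi)).1
  · simpa only [Fin.val_eq_zero, add_zero] using (Finset.mem_filter.1 (hmem i hi)).2

open Classical in
/-- Colour an `(r+1)`-tuple by the function that maps `c` to the length of the longest path of
colour `c` that ends in it. If two consecutive tuples get the same colour, then none of these
paths can be extended, so one of them is long enough already. -/
theorem exists_isTightPath (r : ℕ) (C : Type*) [Finite C] (W : ℕ) : ∃ N : ℕ,
    ∀ χ : (Fin (r + 1) → ℕ) → C, ∃ c a, IsTightPath χ N c W a := by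
  induction r generalizing C W with
  | zero => exact exists_isTightPath_singletons C W
  | succ r ih =>
    obtain ⟨N, hN⟩ := ih (C → Fin (W + 1)) 2
    refine ⟨N, fun χ => ?_⟩
    set EndsIn : (Fin (r + 1) → ℕ) → C → ℕ → Prop := fun u c m =>
      ∃ b, IsTightPath χ N c m b ∧ ∀ v : Fin (r + 1), b (m + v) = u v
    obtain ⟨L, a, ha⟩ := hN fun u c =>
      ⟨Nat.findGreatest (EndsIn u c) W, Nat.lt_succ_iff.2 (Nat.findGreatest_le W)⟩
    set c := χ fun v => a v
    have hlongest : ∀ i < 2, Nat.findGreatest (EndsIn (fun v => a (i + v)) c) W = L c :=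
      fun i hi => congrArg Fin.val (congrFun (ha.color_eq i hi) c)
    have hempty : EndsIn (fun v => a (0 + v)) c 0 :=
      ⟨a, ⟨fun i hi => ha.lt_succ i (by omega), fun i hi => ha.lt_bound i (by omega),
        fun i hi => absurd hi i.not_lt_zero⟩, fun v => rfl⟩
    obtain ⟨b, hb, hba⟩ := Nat.findGreatest_spec W.zero_le hempty
    rw [hlongest 0 two_pos] at hb hba
    rcases (Nat.lt_succ_iff.1 (L c).isLt).eq_or_lt with hW | hW
    · exact ⟨c, b, hW ▸ hb⟩
    · obtain ⟨b', hb', hba'⟩ := hb.exists_extend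
        (fun v hv => (hba ⟨v, Nat.lt_succ_iff.2 hv⟩).trans (congrArg a (zero_add v)))
        (ha.lt_succ r (by omega)) (ha.lt_bound _ (by omega)) rfl
      have hlonger : EndsIn (fun v => a (1 + v)) c (L c + 1) :=
        ⟨b', hb', fun v => (hba' v (by omega)).trans (congrArg a (add_comm _ _))⟩
      have := Nat.le_findGreatest hW hlonger
      rw [hlongest 1 one_lt_two] at this
      omega

theorem infinitePi_real_comp {ι κ X : Type*} [MeasurableSpace X] (ν : Measure X)
    [IsProbabilityMeasure ν] {e : ι → κ} (he : Function.Injective e) {E : Set (ι → X)}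
    (hE : MeasurableSet E) :
    (Measure.infinitePi fun _ : κ => ν).real {x | (fun i => x (e i)) ∈ E} =
      (Measure.infinitePi fun _ : ι => ν).real E := by
  rw [← Measure.map_infinitePi_infinitePi_of_inj (P := fun _ => ν) he,
    map_measureReal_apply (by fun_prop) hE]
  rfl

/-- By `exists_isTightPath`, some reordering of the first `N` terms of the sequence starts with a
monochromatic run, and every reordering has the same law. -/
theorem exists_le_infinitePi_real_run (r K : ℕ) (C : Type*) [Finite C] : ∃ δ : ℝ, 0 < δ ∧
    ∀ {X : Type*} [MeasurableSpace X] (ν : Measure X) [IsProbabilityMeasure ν]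
      (g : (Fin (r + 1) → X) → C) (_ : ∀ c, MeasurableSet (g ⁻¹' {c})),
      ∃ c, δ ≤ (Measure.infinitePi fun _ : ℕ => ν).real
        {x | ∀ i < K, g (fun v => x (i + v)) = c} := by
  have := Fintype.ofFinite C
  obtain ⟨N, hN⟩ := exists_isTightPath r C K
  set M : ℝ := Fintype.card (Fin (K + r) ↪ Fin N) * Fintype.card C
  refine ⟨1 / (M + 1), by positivity, fun {X} _ ν _ g hg => ?_⟩
  set μ := Measure.infinitePi fun _ : ℕ => ν
  set Run : C → Set (Fin (K + r) → X) := fun c =>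
    {x | ∀ i : Fin K, g (fun v => x ⟨i + v, by omega⟩) = c}
  have hRun : ∀ c, MeasurableSet (Run c) := fun c => by
    simp only [Run, Set.ofPred_forall]
    exact MeasurableSet.iInter fun i =>
      (measurable_pi_lambda _ fun v => measurable_pi_apply _ : Measurable fun
        (x : Fin (K + r) → X) (v : Fin (r + 1)) => x ⟨i + v, by omega⟩) (hg c)
  have hreorder : ∀ (a : Fin (K + r) ↪ Fin N) c, μ.real {x | (fun i => x (a i)) ∈ Run c} =
      μ.real {x | ∀ i < K, g (fun v => x (i + v)) = c} := fun a c => by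
    refine (infinitePi_real_comp ν (Fin.val_injective.comp a.injective) (hRun c)).trans ?_
    rw [← infinitePi_real_comp ν Fin.val_injective (hRun c)]
    exact congrArg μ.real (Set.ext fun x => Fin.forall_iff)
  have hcover : Set.univ ⊆ ⋃ p ∈ (Finset.univ : Finset ((Fin (K + r) ↪ Fin N) × C)),
      {x : ℕ → X | (fun i => x (p.1 i)) ∈ Run p.2} := fun x _ => by
    obtain ⟨c, a, ha⟩ := hN fun u => g fun v => x (u v)
    simp only [Set.mem_iUnion, Finset.mem_univ, exists_true_left]
    exact ⟨(⟨fun i => ⟨a i, ha.lt_bound i i.isLt⟩, fun i j hij =>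
      Fin.ext (ha.injOn i.isLt j.isLt (Fin.mk.inj_iff.1 hij))⟩, c), fun i => ha.color_eq i i.isLt⟩
  by_contra! hlt
  have hone : 1 ≤ M * (1 / (M + 1)) := by
    calc (1 : ℝ) = μ.real Set.univ := probReal_univ.symm
      _ ≤ ∑ p : (Fin (K + r) ↪ Fin N) × C, μ.real {x | (fun i => x (p.1 i)) ∈ Run p.2} :=
        (measureReal_mono hcover (measure_ne_top _ _)).trans (measureReal_biUnion_finset_le _ _)
      _ ≤ ∑ _p : (Fin (K + r) ↪ Fin N) × C, 1 / (M + 1) :=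
        Finset.sum_le_sum fun p _ => (hreorder p.1 p.2).trans_le (hlt p.2).le
      _ = M * (1 / (M + 1)) := by simp [M, mul_comm]
  rw [mul_one_div, le_div_iff₀ (by positivity)] at hone
  linarith

/-! ### Runs of equal nodes -/

section Runs

variable {k s : ℕ}

theorem isProbabilityMeasure_coin {p : ℝ} (hp : 0 ≤ p) (hp1 : p ≤ 1) :
    IsProbabilityMeasure (coin p) := by
  constructor
  rw [coin, Measure.add_apply, Measure.smul_apply, Measure.smul_apply, measure_univ, measure_univ,
    smul_eq_mul, smul_eq_mul, mul_one, mul_one, ← ENNReal.ofReal_add hp (by linarith)]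
  simp

instance : IsProbabilityMeasure (coin (1 / 2)) :=
  isProbabilityMeasure_coin (by norm_num) (by norm_num)

theorem coin_half_map_not : (coin (1 / 2)).map (fun b => !b) = coin (1 / 2) := by
  have hnot : Measurable fun b : Bool => !b := measurable_of_countable _
  rw [coin, Measure.map_add _ _ hnot, Measure.map_smul, Measure.map_smul, Measure.map_dirac,
    Measure.map_dirac, add_comm]
  norm_num

/-- The law of an infinite sequence of fair bits. -/
noncomputable def fairBits : Measure (ℕ → Bool) := Measure.infinitePi fun _ => coin (1 / 2)

instance : IsProbabilityMeasure fairBits := by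
  unfold fairBits
  infer_instance

theorem fairBits_real_not {E : Set (ℕ → Bool)} (hE : MeasurableSet E) :
    fairBits.real {x | (fun i => !x i) ∈ E} = fairBits.real E := by
  have hmap := Measure.infinitePi_map_pi (μ := fun _ : ℕ => coin (1 / 2))
    (f := fun _ b => !b) (fun _ => measurable_of_countable _)
  simp only [coin_half_map_not] at hmap
  have hnot : Measurable fun (x : ℕ → Bool) i => !x i :=
    measurable_pi_lambda _ fun i => (measurable_of_countable not).comp (measurable_pi_apply i)
  conv_rhs => rw [fairBits, ← hmap, map_measureReal_apply hnot hE]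
  rfl

theorem fairBits_map_blocks {u : ℕ} (hu : 0 < u) :
    fairBits.map (fun x i (v : Fin u) => x (u * i + v)) =
      Measure.infinitePi fun _ : ℕ => Measure.infinitePi fun _ : Fin u => coin (1 / 2) := by
  have : NeZero u := ⟨hu.ne'⟩
  rw [← Measure.infinitePi_map_curry fun (_ : ℕ) (_ : Fin u) => coin (1 / 2),
    ← Measure.map_infinitePi_infinitePi_of_inj (P := fun _ : ℕ => coin (1 / 2))
      (Nat.divModEquiv u).symm.injective, Measure.map_map (by fun_prop) (by fun_prop), fairBits]
  refine congrArg (Measure.map · _) (funext fun x => funext fun i => funext fun v => ?_)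
  exact congrArg x (congrArg (· + (v : ℕ)) (mul_comm u i))

theorem measurable_layer (φ : ℕ → BoolFilter k) (t j : ℕ) :
    Measurable fun x => layer s φ t x j := by
  induction t generalizing j with
  | zero => exact measurable_pi_apply j
  | succ t ih => exact (measurable_of_countable (φ t)).comp (measurable_pi_lambda _ fun r => ih _)

theorem measurableSet_run (φ : ℕ → BoolFilter k) (t K : ℕ) (c : Bool) :
    MeasurableSet {x | ∀ i < K, layer s φ t x i = c} := by
  simp only [Set.ofPred_forall]
  exact MeasurableSet.iInter fun i => MeasurableSet.iInter fun _ =>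
    measurable_layer φ t i (measurableSet_singleton c)

/-- A node of layer `t` as a function of the `2 * k + 1` blocks of inputs, each of length `s ^ t`,
that form its receptive field. -/
def blockFilter (s : ℕ) (φ : ℕ → BoolFilter k) (t : ℕ)
    (w : Fin (2 * k + 1) → Fin (s ^ t) → Bool) : Bool :=
  layer s φ t (extend fun v : Fin ((2 * k + 1) * s ^ t) => w v.divNat v.modNat) 0

theorem blockFilter_eq_layer (hs : 2 ≤ s) (φ : ℕ → BoolFilter k) (t i : ℕ) (x : ℕ → Bool) :
    blockFilter s φ t (fun r v => x (s ^ t * (i + r) + v)) = layer s φ t x i := by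
  refine layer_congr hs φ fun v hv => ?_
  rw [mul_zero, zero_add, extend_apply _ hv]
  refine congrArg x ?_
  rw [Fin.coe_divNat, Fin.coe_modNat, mul_add, add_assoc, Nat.div_add_mod]

theorem fairBits_real_run_false {φ : ℕ → BoolFilter k} {t : ℕ} (hφ : ∀ a < t, IsOdd (φ a))
    (K : ℕ) : fairBits.real {x | ∀ i < K, layer s φ t x i = false} =
      fairBits.real {x | ∀ i < K, layer s φ t x i = true} := by
  rw [← fairBits_real_not (measurableSet_run φ t K false)]
  refine congrArg fairBits.real (Set.ext fun x => forall₂_congr fun i _ => ?_)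
  rw [show layer s φ t (fun j => !x j) i = !layer s φ t x i from IsOdd.layer hφ i x,
    Bool.not_eq_false']

theorem exists_le_fairBits_real_run (k K : ℕ) : ∃ δ : ℝ, 0 < δ ∧ ∀ (s : ℕ) (_ : 2 ≤ s)
    (φ : ℕ → BoolFilter k) (t : ℕ), (∀ a < t, IsOdd (φ a)) →
      δ ≤ fairBits.real {x | ∀ i < K, layer s φ t x i = true} := by
  obtain ⟨δ, hδ, hrun⟩ := exists_le_infinitePi_real_run (2 * k) K Bool
  refine ⟨δ, hδ, fun s hs φ t hφ => ?_⟩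
  obtain ⟨c, hc⟩ := hrun (Measure.infinitePi fun _ : Fin (s ^ t) => coin (1 / 2))
    (blockFilter s φ t) fun c => (Set.toFinite _).measurableSet
  have hmeas : MeasurableSet {x : ℕ → Fin (s ^ t) → Bool |
      ∀ i < K, blockFilter s φ t (fun r => x (i + r)) = c} := by
    simp only [Set.ofPred_forall]
    exact MeasurableSet.iInter fun i => MeasurableSet.iInter fun _ =>
      (measurable_of_countable (blockFilter s φ t)).comp
        (measurable_pi_lambda _ fun r => measurable_pi_apply _) (measurableSet_singleton c)
  rw [← fairBits_map_blocks (by positivity), map_measureReal_apply (by fun_prop) hmeas] at hc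
  simp only [Set.preimage_ofPred_eq, blockFilter_eq_layer hs] at hc
  cases c
  · rwa [fairBits_real_run_false hφ] at hc
  · exact hc

end Runs

/-! ### Shielded blocks of the network -/

theorem integral_pi_coin_half {ι : Type*} [Fintype ι] [DecidableEq ι] (g : (ι → Bool) → ℝ) :
    ∫ ω, g ω ∂(Measure.pi fun _ : ι => coin (1 / 2)) = 𝔼 ω, g ω := by
  have hcoin : ∀ b : Bool, coin (1 / 2) {b} = ENNReal.ofReal (1 / 2) := fun b => by
    cases b
    · simp only [coin, Measure.add_apply, Measure.smul_apply, smul_eq_mul]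
      norm_num
    · simp [coin]
  have hsingleton : ∀ ω : ι → Bool, (Measure.pi fun _ : ι => coin (1 / 2)).real {ω} =
      (1 / 2) ^ Fintype.card ι := fun ω => by
    rw [measureReal_def, Measure.pi_singleton]
    simp only [hcoin, Finset.prod_const, Finset.card_univ]
    rw [ENNReal.toReal_pow, ENNReal.toReal_ofReal (by norm_num)]
  rw [integral_fintype Integrable.of_finite, Fintype.expect_eq_sum_div_card]
  simp only [hsingleton, smul_eq_mul, ← Finset.mul_sum, Fintype.card_fun, Fintype.card_bool]
  rw [one_div, inv_pow, inv_mul_eq_div]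
  norm_num

theorem expect_indicator_one {N : ℕ} (E : Set (Fin N → Bool)) :
    𝔼 ω, E.indicator (1 : (Fin N → Bool) → ℝ) ω =
      fairBits.real {x | (fun i : Fin N => x i) ∈ E} := by
  have hE : MeasurableSet E := E.toFinite.measurableSet
  rw [← integral_pi_coin_half, integral_indicator_one hE, ← Measure.infinitePi_eq_pi]
  exact (infinitePi_real_comp _ Fin.val_injective hE).symm

theorem extend_congr {N : ℕ} {ω ω' : Fin N → Bool} {i : ℕ}
    (h : ∀ hi : i < N, ω ⟨i, hi⟩ = ω' ⟨i, hi⟩) : extend ω i = extend ω' i := by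
  unfold extend
  split_ifs with hi
  exacts [h hi, rfl]

section Shield

variable {k s : ℕ}

theorem layer_congr_of_div (hs : 2 ≤ s) (φ : ℕ → BoolFilter k) {x y : ℕ → Bool} {t l : ℕ}
    (h : ∀ i, l ≤ i / s ^ t → i / s ^ t ≤ l + 2 * k → x i = y i) :
    layer s φ t x l = layer s φ t y l := by
  have hu : 0 < s ^ t := by positivity
  refine layer_congr hs φ fun v hv => h _ ?_ ?_
  · rw [Nat.mul_add_div hu]
    exact Nat.le_add_right _ _
  · rw [Nat.mul_add_div hu]
    have := (Nat.div_lt_iff_lt_mul hu).2 hv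
    omega

theorem network_eq_layer_extend {t e : ℕ} (φ : ℕ → BoolFilter k)
    (ω : Fin (width k s (t + e)) → Bool) :
    network k s (t + e) φ ω = layer s (fun a => φ (t + a)) e
      (extend fun l : Fin (width k s e) => layer s φ t (extend ω) l) 0 := by
  rw [network_eq_layer, layer_add]
  refine layer_congr_width (m := 0) _ (fun l hl => ?_) (width_pos k s 0)
  rw [zero_add] at hl
  exact (extend_apply (fun l : Fin (width k s e) => layer s φ t (extend ω) l) hl).symm

/-- The nodes `l` of two runs of length `R` in a layer, on both sides of the nodes that depend on
the blocks of inputs number `X` and `X + 1`. -/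
def IsFlank (k R X l : ℕ) : Prop :=
  (X ≤ l + (2 * k + R) ∧ l + 2 * k < X) ∨ (X + 2 ≤ l ∧ l < X + 2 + R)

/-- Deleting the blocks `X` and `X + 1` turns the two flanks into parts of one run. -/
theorem fairBits_real_run_le_flanks (hs : 2 ≤ s) (φ : ℕ → BoolFilter k) (t X R : ℕ) :
    fairBits.real {x | ∀ i < 2 * k + 2 * R, layer s φ t x i = true} ≤
      fairBits.real {x | ∀ l, IsFlank k R X l → layer s φ t x l = true} := by
  set u := s ^ t
  set X₀ := X - (2 * k + R)
  set e : ℕ → ℕ := fun i => if i + u * X₀ < u * X then i + u * X₀ else i + u * X₀ + u * 2 with he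
  have hinj : Function.Injective e := fun i j hij => by
    simp only [he] at hij
    split_ifs at hij <;> omega
  refine (infinitePi_real_comp _ hinj (measurableSet_run φ t _ true)).symm.le.trans
    (measureReal_mono (fun x hx l hl => ?_) (measure_ne_top _ _))
  rcases hl with ⟨hXl, hlX⟩ | ⟨hXl, hlX⟩
  · rw [← hx (l - X₀) (by omega)]
    refine layer_congr hs φ fun v (hv : v < (2 * k + 1) * u) => ?_
    change x (u * l + v) = x (e (u * (l - X₀) + v))
    have hmul : u * (l - X₀) + u * X₀ = u * l := by rw [← mul_add, Nat.sub_add_cancel (by omega)]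
    have hlt : u * l + v < u * X := by
      have := Nat.mul_le_mul_left u (show l + (2 * k + 1) ≤ X by omega)
      linarith
    simp only [he]
    rw [if_pos (by omega)]
    exact congrArg x (by omega)
  · rw [← hx (l - X₀ - 2) (by omega)]
    refine layer_congr hs φ fun v _ => ?_
    change x (u * l + v) = x (e (u * (l - X₀ - 2) + v))
    have hmul : u * (l - X₀ - 2) + u * X₀ + u * 2 = u * l := by
      rw [← mul_add, ← mul_add]
      exact congrArg (u * ·) (by omega)
    have hle : u * X ≤ u * (l - X₀ - 2) + u * X₀ := by
      rw [← mul_add]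
      exact Nat.mul_le_mul_left u (by omega)
    simp only [he]
    rw [if_neg (by omega)]
    exact congrArg x (by omega)

/-- A set of blocks is shielded by runs of `true` on its flanks in layer `t`, since the following
majority layers erase all disagreement between these runs. -/
theorem shielded_network (hk : 1 ≤ k) (hs : 2 ≤ s) {p : ℕ} (hp : 2 * k + 2 ≤ s ^ p) {δ : ℝ}
    {φ : ℕ → BoolFilter k} {n t : ℕ} (hn : t + (p + 1) ≤ n)
    (hmaj : ∀ a ≤ p, φ (t + a) = majority k)
    (hrun : δ ≤ fairBits.real {x | ∀ i < 2 * k + 2 * radius k s p, layer s φ t x i = true})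
    {β : Fin (width k s n) → ℕ} {ψ : ℕ → ℕ} {i X : ℕ}
    (hβ : ∀ y : Fin (width k s n), β y = i → X ≤ y / s ^ t ∧ y / s ^ t < X + 2)
    (hψ : ∀ y : Fin (width k s n), X ≤ y / s ^ t + (2 * k + radius k s p) →
      y / s ^ t < X + 2 + (2 * k + radius k s p) → ψ (β y) = ψ i) :
    Shielded (fun ω => sgn (network k s n φ ω)) β ψ δ i := by
  obtain ⟨e, rfl⟩ : ∃ e, n = t + (p + 1 + e) := ⟨n - (t + (p + 1)), by omega⟩
  set R := radius k s p
  set cut : (Fin (width k s (t + (p + 1 + e))) → Bool) → ℕ → Bool := fun ω =>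
    extend fun l : Fin (width k s (p + 1 + e)) => layer s φ t (extend ω) l
  set E := {ω | ∀ l, IsFlank k R X l → cut ω l = true}
  have hcut : ∀ ω ω' l, (∀ y : Fin (width k s (t + (p + 1 + e))),
      l ≤ y / s ^ t → y / s ^ t ≤ l + 2 * k → ω y = ω' y) → cut ω l = cut ω' l :=
    fun ω ω' l h => extend_congr fun _ => layer_congr_of_div hs φ fun i hli hil =>
      extend_congr fun hi => h ⟨i, hi⟩ hli hil
  have hE : DependsOn (· ∈ E) (siblings β ψ i : Set _) := fun ω ω' h =>
    propext (forall₂_congr fun l hl => by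
      rw [hcut ω ω' l fun y hly hyl => h y (mem_siblings.2 ⟨hψ y ?_ ?_, mt (hβ y) ?_⟩)]
      all_goals unfold IsFlank at hl; omega)
  refine ⟨E, hE, fun ω ω' h => ?_, ?_⟩
  · have hmem : ω ∈ E ↔ ω' ∈ E := iff_of_eq (hE fun y hy => h y (mem_siblings.1 hy).2)
    by_cases hω : ω ∈ E
    · have hagree : AgreeOff (X - 2 * k) (X + 2) R (cut ω) (cut ω') :=
        ⟨fun l hl => hcut ω ω' l fun y hly hyl => h y fun hy => by have := hβ y hy; omega,
          fun l hl hl' => hω l (Or.inl (by omega)), fun l hl hl' => hω l (Or.inr ⟨hl, hl'⟩)⟩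
      rw [Set.indicator_of_mem hω, Set.indicator_of_mem (hmem.1 hω), network_eq_layer_extend,
        network_eq_layer_extend, layer_add _ (p + 1), layer_add _ (p + 1),
        hagree.layer_eq hk hs hmaj (by omega) (by omega)]
    · rw [Set.indicator_of_notMem hω, Set.indicator_of_notMem (mt hmem.2 hω)]
  · rw [expect_indicator_one]
    refine hrun.trans ((fairBits_real_run_le_flanks hs φ t X R).trans
      (measureReal_mono (fun x hx l hl => ?_) (measure_ne_top _ _)))
    by_cases hlw : l < width k s (p + 1 + e)
    · refine (extend_apply _ hlw).trans (Eq.trans ?_ (hx l hl))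
      refine layer_congr_width φ (fun j hj => extend_apply _ ?_) hlw
      rwa [add_comm t]
    · exact dif_neg hlw

end Shield

/-! ### Contraction of the stability over a window of majority layers -/

section Decay

variable {k s : ℕ}

/-- The map that sends a block to its coarse block of length `Q`, for a grid of coarse blocks that
is shifted if `b = true`. -/
def coarsen (m Q : ℕ) (b : Bool) (i : ℕ) : ℕ := (i + if b then 2 * m else 0) / Q

theorem exists_coarsen_eq_of_near {m Q : ℕ} (hQ : 4 * m < Q) (i : ℕ) :
    ∃ b, ∀ j, i ≤ j + m → j ≤ i + m → coarsen m Q b j = coarsen m Q b i := by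
  have hinner : ∃ b : Bool, m ≤ (i + if b then 2 * m else 0) % Q ∧
      (i + if b then 2 * m else 0) % Q + m < Q := by
    by_cases h : m ≤ i % Q ∧ i % Q + m < Q
    · exact ⟨false, by simpa using h⟩
    · refine ⟨true, ?_⟩
      have hr := Nat.mod_lt i (show 0 < Q by omega)
      rw [if_pos rfl, ← Nat.mod_add_mod]
      rcases lt_or_ge (i % Q + 2 * m) Q with hlt | hge
      · rw [Nat.mod_eq_of_lt hlt]
        omega
      · rw [Nat.mod_eq_sub_mod hge, Nat.mod_eq_of_lt (by omega)]
        omega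
  obtain ⟨b, hleft, hright⟩ := hinner
  refine ⟨b, fun j hij hji => ?_⟩
  simp only [coarsen]
  set c := if b then 2 * m else 0
  have hdiv := Nat.div_add_mod (i + c) Q
  refine Nat.div_eq_of_lt_le ?_ ?_
  · rw [mul_comm]
    omega
  · rw [mul_comm, Nat.mul_succ]
    omega

theorem encard_coarsen_preimage_le {Q : ℕ} (hQ : 0 < Q) (m : ℕ) (b : Bool) (i : ℕ) :
    (coarsen m Q b ⁻¹' {i}).encard ≤ Q := by
  calc (coarsen m Q b ⁻¹' {i}).encard
      ≤ (Finset.Ico (i * Q) (i * Q + Q) : Set ℕ).encard := by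
        refine Set.encard_le_encard_of_injOn (f := (· + if b then 2 * m else 0)) (fun j hj => ?_)
          ((add_left_injective _).injOn)
        have hj : _ / Q = i := hj
        rw [Finset.coe_Ico, Set.mem_Ico, ← hj]
        exact ⟨Nat.div_mul_le_self _ _, Nat.lt_div_mul_add hQ⟩
    _ = Q := by
        rw [Set.encard_coe_eq_coe_finsetCard, Nat.card_Ico, Nat.add_sub_cancel_left]

theorem coarsen_div {u : ℕ} (hu : 0 < u) (m Q : ℕ) (b : Bool) (i : ℕ) :
    coarsen m Q b (i / u) = (i + (if b then 2 * m else 0) * u) / (u * Q) := by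
  rw [coarsen, ← Nat.add_mul_div_right _ _ hu, Nat.div_div_eq_div_mul]

theorem blockStability_sgn_le_one {ι : Type*} [Fintype ι] [DecidableEq ι] {l : ℝ} (hl : 0 ≤ l)
    (hl1 : l ≤ 1) (f : (ι → Bool) → Bool) (β : ι → ℕ) :
    blockStability l (fun ω => sgn (f ω)) β ≤ 1 := by
  calc blockStability l (fun ω => sgn (f ω)) β
      ≤ ∑ S, walshCoeff (fun ω => sgn (f ω)) S ^ 2 :=
        (Finset.sum_le_sum fun S _ => mul_le_of_le_one_right (sq_nonneg _)
          (pow_le_one₀ hl hl1)).trans (Finset.sum_le_univ_sum_of_nonneg fun S => sq_nonneg _)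
    _ = 1 := by
        rw [sum_walshCoeff_sq]
        simp only [pow_two, sgn_mul_self]
        exact Fintype.expect_const 1

/-- The shifts by `o` of the grids of blocks are there only because consecutive coarsenings must be
allowed to use different grids. -/
theorem exists_window_contraction (hk : 1 ≤ k) (hs : 2 ≤ s) : ∃ q : ℕ, 0 < q ∧ ∃ c : ℝ, 0 < c ∧
    ∀ (l : ℝ) (_ : 0 ≤ l) (_ : l ≤ 1) (n t o : ℕ) (φ : ℕ → BoolFilter k)
      (_ : ∀ a < n, IsOdd (φ a)) (_ : t + q ≤ n) (_ : ∀ a < q, φ (t + a) = majority k), ∃ o',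
      blockStability l (fun ω => sgn (network k s n φ ω)) (fun y => (y + o) / s ^ t) ≤
        (1 + c * (1 - l))⁻¹ *
          blockStability l (fun ω => sgn (network k s n φ ω))
            (fun y => (y + o') / s ^ (t + q)) := by
  set p := 2 * k + 2
  have hp : 2 * k + 2 ≤ s ^ p := (Nat.lt_pow_self (show 1 < s by omega)).le
  set R := radius k s p
  obtain ⟨δ, hδ0, hδ⟩ := exists_le_fairBits_real_run k (2 * k + 2 * R)
  have hδ1 : δ ≤ 1 :=
    (hδ 2 le_rfl (fun _ => majority k) 0 fun a ha => absurd ha a.not_lt_zero).trans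
      measureReal_le_one
  set m := 2 * k + R + 3
  set q := 4 * m + p + 1
  have hQ : 4 * m < s ^ q := lt_trans (by omega) (Nat.lt_pow_self (show 1 < s by omega))
  refine ⟨q, by omega, δ / (2 * ((s ^ q : ℕ) + 1)), by positivity,
    fun l hl hl1 n t o φ hφ hn hmaj => ?_⟩
  have hu : 0 < s ^ t := by positivity
  obtain ⟨b, hb⟩ := exists_blockStability_le hl hl1 hδ0.le hδ1
    (fun ω => sgn (network k s n φ ω)) (fun y => (y + o) / s ^ t) (coarsen m (s ^ q))
    (encard_coarsen_preimage_le (by omega) m) fun y₀ => by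
      obtain ⟨b, hb⟩ := exists_coarsen_eq_of_near hQ ((y₀ + o) / s ^ t)
      have hgrid : ∀ y, y / s ^ t + o / s ^ t ≤ (y + o) / s ^ t ∧
          (y + o) / s ^ t ≤ y / s ^ t + o / s ^ t + 1 :=
        fun y => ⟨Nat.div_add_div_le_add_div, Nat.add_div_le_div_add_div_add_one _ _ _⟩
      have hy₀ := hgrid y₀
      refine ⟨b, shielded_network hk hs hp (X := (y₀ + o) / s ^ t - o / s ^ t - 1) (by omega)
        (fun a ha => hmaj a (by omega)) (hδ s hs φ t fun a ha => hφ a (by omega))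
        (fun y hy => ?_) (fun y hXy hyX => hb _ ?_ ?_)⟩
      all_goals
        have := hgrid y
        generalize (y : ℕ) / s ^ t = i, (y₀ : ℕ) / s ^ t = i₀, o / s ^ t = j,
          (y + o) / s ^ t = i' at *
        omega
  refine ⟨o + (if b then 2 * m else 0) * s ^ t, hb.trans_eq ?_⟩
  rw [div_mul_eq_mul_div, pow_add s t q]
  exact congrArg (_ * blockStability _ _ ·) (funext fun y => by
    rw [Function.comp_apply, coarsen_div hu, add_assoc])

/-- The windows `[q j, q j + q)` of layers, for `j < J`, that consist of majority layers. -/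
def majorityWindows (q J : ℕ) (φ : ℕ → BoolFilter k) : Finset ℕ :=
  (Finset.range J).filter fun j => ∀ a < q, φ (q * j + a) = majority k

theorem exists_blockStability_network_le (hk : 1 ≤ k) (hs : 2 ≤ s) : ∃ q : ℕ, 0 < q ∧ ∃ c : ℝ,
    0 < c ∧ ∀ (l : ℝ) (_ : 0 ≤ l) (_ : l ≤ 1) (n : ℕ) (φ : ℕ → BoolFilter k)
      (_ : ∀ a < n, IsOdd (φ a)),
      blockStability l (fun ω => sgn (network k s n φ ω)) (fun y => (y : ℕ)) ≤
        (1 + c * (1 - l))⁻¹ ^ (majorityWindows q (n / q) φ).card := by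
  obtain ⟨q, hq, c, hc, hwindow⟩ := exists_window_contraction hk hs
  refine ⟨q, hq, c, hc, fun l hl hl1 n φ hφ => ?_⟩
  set κ := (1 + c * (1 - l))⁻¹
  have hκ : 0 ≤ κ := inv_nonneg.2 (by have := sub_nonneg.2 hl1; positivity)
  set f : (Fin (width k s n) → Bool) → ℝ := fun ω => sgn (network k s n φ ω)
  have hiterate : ∀ J ≤ n / q, ∃ o, blockStability l f (fun y => (y : ℕ)) ≤
      κ ^ (majorityWindows q J φ).card * blockStability l f (fun y => (y + o) / s ^ (q * J)) := by
    intro J hJ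
    induction J with
    | zero => exact ⟨0, by simp [majorityWindows]⟩
    | succ J ih =>
      obtain ⟨o, ho⟩ := ih (by omega)
      rw [mul_add_one, majorityWindows, Finset.range_add_one, Finset.filter_insert]
      split_ifs with hmaj
      · have hn : q * J + q ≤ n := (mul_add_one q J).ge.trans
          (mul_comm q _ ▸ (Nat.le_div_iff_mul_le hq).1 hJ)
        obtain ⟨o', ho'⟩ := hwindow l hl hl1 n (q * J) o φ hφ hn hmaj
        refine ⟨o', ?_⟩
        rw [Finset.card_insert_of_notMem (by simp), pow_succ, mul_assoc]
        exact ho.trans (mul_le_mul_of_nonneg_left ho' (pow_nonneg hκ _))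
      · refine ⟨o, ho.trans (mul_le_mul_of_nonneg_left ?_ (pow_nonneg hκ _))⟩
        simpa only [Function.comp_def, Nat.div_div_eq_div_mul, ← pow_add] using
          blockStability_le_comp hl hl1 f (fun y => (y + o) / s ^ (q * J)) (· / s ^ q)
  obtain ⟨o, ho⟩ := hiterate _ le_rfl
  exact ho.trans (mul_le_of_le_one_right (pow_nonneg hκ _) (blockStability_sgn_le_one hl hl1 _ _))

end Decay

/-! ### The noise covariance as a stability -/

section Noise

variable {N : ℕ} {ε : ℝ}

theorem isProbabilityMeasure_noiseLaw (h0 : 0 ≤ ε) (h1 : ε ≤ 1) :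
    IsProbabilityMeasure (noiseLaw N ε) := by
  have := isProbabilityMeasure_coin h0 h1
  exact Measure.isProbabilityMeasure_map (measurable_of_countable _).aemeasurable

theorem integral_noiseLaw (h0 : 0 ≤ ε) (h1 : ε ≤ 1) (g : (Fin N → Bool) × (Fin N → Bool) → ℝ) :
    ∫ p, g p ∂noiseLaw N ε = ∫ η, 𝔼 ω, g (ω, fun i => xor (ω i) (η i))
      ∂(Measure.pi fun _ : Fin N => coin ε) := by
  have := isProbabilityMeasure_coin h0 h1
  rw [noiseLaw, integral_map (measurable_of_countable _).aemeasurable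
    (measurable_of_countable _).aestronglyMeasurable, integral_prod_symm _ Integrable.of_finite]
  simp only [integral_pi_coin_half]

theorem integral_noiseLaw_fst (h0 : 0 ≤ ε) (h1 : ε ≤ 1) (g : (Fin N → Bool) → ℝ) :
    ∫ p, g p.1 ∂noiseLaw N ε = 𝔼 ω, g ω := by
  have := isProbabilityMeasure_coin h0 h1
  simp [integral_noiseLaw h0 h1]

theorem integral_noiseLaw_snd (h0 : 0 ≤ ε) (h1 : ε ≤ 1) (g : (Fin N → Bool) → ℝ) :
    ∫ p, g p.2 ∂noiseLaw N ε = 𝔼 ω, g ω := by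
  have := isProbabilityMeasure_coin h0 h1
  simp only [integral_noiseLaw h0 h1, ← walshCoeff_empty, walshCoeff_xor]
  simp

theorem integral_neg_sgn_coin (h0 : 0 ≤ ε) (h1 : ε ≤ 1) : ∫ b, -sgn b ∂coin ε = 1 - 2 * ε := by
  have := isProbabilityMeasure_coin h0 h1
  have htrue : (coin ε).real {true} = ε := by simp [measureReal_def, coin, h0]
  have hfalse : (coin ε).real {false} = 1 - ε := by simp [measureReal_def, coin, h1]
  rw [integral_fintype Integrable.of_finite, Fintype.sum_bool, htrue, hfalse]
  simp only [sgn, if_true, smul_eq_mul, Bool.false_eq_true, if_false]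
  ring

theorem integral_prod_neg_sgn_coin (h0 : 0 ≤ ε) (h1 : ε ≤ 1) (S : Finset (Fin N)) :
    ∫ η, ∏ i ∈ S, -sgn (η i) ∂(Measure.pi fun _ : Fin N => coin ε) = (1 - 2 * ε) ^ S.card := by
  have := isProbabilityMeasure_coin h0 h1
  calc ∫ η, ∏ i ∈ S, -sgn (η i) ∂(Measure.pi fun _ : Fin N => coin ε)
      = ∏ i, ∫ b, (if i ∈ S then -sgn b else 1) ∂coin ε := by
        rw [← integral_fintype_prod_eq_prod (fun i b => if i ∈ S then -sgn b else (1 : ℝ))]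
        simp only [Finset.prod_ite_mem, Finset.univ_inter]
    _ = ∏ i, if i ∈ S then 1 - 2 * ε else 1 := by
        refine Finset.prod_congr rfl fun i _ => ?_
        split_ifs
        · exact integral_neg_sgn_coin h0 h1
        · rw [integral_const, probReal_univ, one_smul]
    _ = (1 - 2 * ε) ^ S.card := by
        rw [Finset.prod_ite_mem, Finset.univ_inter, Finset.prod_const]

theorem integral_noiseLaw_mul (h0 : 0 ≤ ε) (h1 : ε ≤ 1) (g h : (Fin N → Bool) → ℝ) :
    ∫ p, g p.1 * h p.2 ∂noiseLaw N ε =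
      ∑ S, walshCoeff g S * walshCoeff h S * (1 - 2 * ε) ^ S.card := by
  have := isProbabilityMeasure_coin h0 h1
  simp only [integral_noiseLaw h0 h1, expect_mul_eq_sum, walshCoeff_xor, ← mul_assoc]
  rw [integral_finsetSum _ fun _ _ => Integrable.of_finite]
  simp only [integral_const_mul, integral_prod_neg_sgn_coin h0 h1]

theorem covariance_noiseLaw (h0 : 0 ≤ ε) (h1 : ε ≤ 1) (g h : (Fin N → Bool) → ℝ) :
    covariance (fun p => g p.1) (fun p => h p.2) (noiseLaw N ε) =
      ∑ S with S.Nonempty, walshCoeff g S * walshCoeff h S * (1 - 2 * ε) ^ S.card := by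
  have := isProbabilityMeasure_noiseLaw (N := N) h0 h1
  have hmul := integral_noiseLaw_mul h0 h1 g h
  rw [← Finset.add_sum_erase _ _ (Finset.mem_univ ∅), walshCoeff_empty, walshCoeff_empty,
    Finset.card_empty, pow_zero, mul_one] at hmul
  rw [covariance_eq_sub MemLp.of_discrete MemLp.of_discrete, integral_noiseLaw_fst h0 h1,
    integral_noiseLaw_snd h0 h1]
  simp only [Pi.mul_apply, hmul, add_sub_cancel_left, Finset.nonempty_iff_ne_empty,
    Finset.filter_ne']

theorem noiseCov_eq_blockStability (h0 : 0 ≤ ε) (h1 : ε ≤ 1) (f : (Fin N → Bool) → Bool) :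
    noiseCov f ε = blockStability (1 - 2 * ε) (fun ω => sgn (f ω)) (fun y => (y : ℕ)) := by
  rw [noiseCov, covariance_noiseLaw h0 h1 (fun ω => sgn (f ω)) (fun ω => sgn (f ω))]
  simp only [blockStability, pow_two, Finset.card_image_of_injective _ Fin.val_injective]

theorem noiseCov_nonneg (h0 : 0 ≤ ε) (h1 : ε ≤ 1 / 2) (f : (Fin N → Bool) → Bool) :
    0 ≤ noiseCov f ε := by
  rw [noiseCov_eq_blockStability h0 (by linarith)]
  exact blockStability_nonneg (by linarith) _ _

theorem IsOdd.expect_sgn_eq_zero {ι : Type*} [Fintype ι] [DecidableEq ι] {f : (ι → Bool) → Bool}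
    (hf : IsOdd f) : 𝔼 ω, sgn (f ω) = 0 := by
  have hinv : Function.Involutive fun (ω : ι → Bool) i => !ω i := fun ω => by simp
  have hneg : 𝔼 ω, sgn (f ω) = 𝔼 ω, -sgn (f ω) :=
    Fintype.expect_equiv hinv.toPerm _ _ fun ω => by
      rw [Function.Involutive.coe_toPerm, hf, sgn_not, neg_neg]
  rw [Finset.expect_neg_distrib] at hneg
  linarith

/-- Odd functions have mean zero, so averaging over the function adds no covariance. -/
theorem covariance_prod_noiseLaw {π : Measure ((Fin N → Bool) → Bool)} [IsProbabilityMeasure π]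
    (h0 : 0 ≤ ε) (h1 : ε ≤ 1) (hπ : ∀ᵐ f ∂π, IsOdd f) :
    covariance (fun q => sgn (q.1 q.2.1)) (fun q => sgn (q.1 q.2.2)) (π.prod (noiseLaw N ε)) =
      ∫ f, noiseCov f ε ∂π := by
  have := isProbabilityMeasure_noiseLaw (N := N) h0 h1
  have hmean : ∀ᵐ f ∂π, ∫ p, sgn (f p.1) ∂noiseLaw N ε = 0 := hπ.mono fun f hf => by
    rw [integral_noiseLaw_fst h0 h1 fun ω => sgn (f ω), hf.expect_sgn_eq_zero]
  rw [covariance_eq_sub MemLp.of_discrete MemLp.of_discrete,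
    integral_prod _ Integrable.of_finite, integral_prod _ Integrable.of_finite,
    integral_eq_zero_of_ae hmean, zero_mul, sub_zero]
  refine integral_congr_ae (hmean.mono fun f hf => ?_)
  change _ = noiseCov f ε
  rw [noiseCov, covariance_eq_sub MemLp.of_discrete MemLp.of_discrete, hf, zero_mul, sub_zero]
  rfl

end Noise

/-! ### Ancestors -/

section Ancestors

variable {k s : ℕ}

theorem IsAncestor.bounds (hs : 2 ≤ s) {m d : ℕ} {i : Fin (width k s m)}
    {j : Fin (width k s (m + d))} (h : IsAncestor k s m d i j) :
    s ^ d * i ≤ j ∧ (j : ℕ) + 2 * k ≤ s ^ d * (i + 2 * k) := by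
  induction d with
  | zero =>
    obtain rfl : i = j := h
    simp
  | succ d ih =>
    obtain ⟨l, r, hl, rfl⟩ := h
    obtain ⟨hlower, hupper⟩ := ih hl
    have hr := r.isLt
    have hsk := Nat.mul_le_mul_right (2 * k) hs
    rw [pow_succ', mul_assoc, mul_assoc]
    constructor
    · calc s * (s ^ d * i) ≤ s * l := Nat.mul_le_mul_left s hlower
        _ ≤ s * l + r := Nat.le_add_right _ _
    · calc s * (l : ℕ) + r + 2 * k ≤ s * l + s * (2 * k) := by omega
        _ = s * (l + 2 * k) := (mul_add _ _ _).symm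
        _ ≤ s * (s ^ d * (i + 2 * k)) := Nat.mul_le_mul_left s hupper

theorem ncard_isAncestor_le (hk : 1 ≤ k) (hs : 2 ≤ s) (m d : ℕ) (j : Fin (width k s (m + d))) :
    {i : Fin (width k s m) | IsAncestor k s m d i j}.ncard ≤ 2 * k := by
  have hu : 0 < s ^ d := by positivity
  have hnear : ∀ i : Fin (width k s m), IsAncestor k s m d i j →
      (i : ℕ) ≤ j / s ^ d ∧ (j : ℕ) / s ^ d < i + 2 * k := fun i hi => by
    obtain ⟨hlower, hupper⟩ := hi.bounds hs
    rw [Nat.le_div_iff_mul_le hu, Nat.div_lt_iff_lt_mul hu, mul_comm (i : ℕ), mul_comm (_ + _)]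
    exact ⟨hlower, by omega⟩
  calc {i : Fin (width k s m) | IsAncestor k s m d i j}.ncard
      ≤ (Finset.range (2 * k) : Set ℕ).ncard :=
        Set.ncard_le_ncard_of_injOn (fun i => (j : ℕ) / s ^ d - i)
          (fun i hi => Finset.mem_coe.2 (Finset.mem_range.2 (by have := hnear i hi; omega)))
          (fun i hi i' hi' heq => Fin.ext (by
            have := hnear i hi
            have := hnear i' hi'
            dsimp only at heq
            omega)) (Finset.finite_toSet _)
    _ = 2 * k := by rw [Set.ncard_coe_finset, Finset.card_range]

end Ancestors

/-! ### Noise sensitivity with random filters -/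

section Windows

variable {Ω : Type*} [MeasurableSpace Ω] {P : Measure Ω}

theorem measure_biInter_windows {A : ℕ → Set Ω} (hA : iIndepSet A P) (q : ℕ) (T : Finset ℕ) :
    P (⋂ j ∈ T, ⋂ a : Fin q, A (q * j + a)) = ∏ j ∈ T, ∏ a : Fin q, P (A (q * j + a)) := by
  have hinj : Function.Injective fun z : ℕ × Fin q => q * z.1 + z.2 := fun z z' hz => by
    have hq : 0 < q := z.2.pos
    have hdiv := congrArg (· / q) hz
    have hmod := congrArg (· % q) hz
    simp only [Nat.mul_add_div hq, Nat.div_eq_of_lt (Fin.is_lt _), Nat.mul_add_mod,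
      Nat.mod_eq_of_lt (Fin.is_lt _), add_zero] at hdiv hmod
    exact Prod.ext hdiv (Fin.ext hmod)
  have hprod := (hA.precomp hinj).meas_biInter (T ×ˢ Finset.univ)
  rw [Finset.prod_product] at hprod
  refine Eq.trans (congrArg P ?_) hprod
  ext w
  simp [forall_comm (α := _ ∈ T)]

theorem iIndepSet_windows {A : ℕ → Set Ω} (hAm : ∀ t, MeasurableSet (A t)) (hA : iIndepSet A P)
    (q : ℕ) : iIndepSet (fun j => ⋂ a : Fin q, A (q * j + a)) P := by
  refine (iIndepSet_iff_meas_biInter fun j => MeasurableSet.iInter fun a => hAm _).2 fun T => ?_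
  rw [measure_biInter_windows hA]
  refine Finset.prod_congr rfl fun j _ => ?_
  simpa using (measure_biInter_windows hA q {j}).symm

theorem pow_le_measureReal_window {A : ℕ → Set Ω} (hA : iIndepSet A P) {c : ℝ} (hc0 : 0 ≤ c)
    (hc : ∀ t, c ≤ P.real (A t)) (q j : ℕ) : c ^ q ≤ P.real (⋂ a : Fin q, A (q * j + a)) := by
  have hprod : P (⋂ a : Fin q, A (q * j + a)) = ∏ a : Fin q, P (A (q * j + a)) := by
    simpa using measure_biInter_windows hA q {j}
  rw [measureReal_def, hprod, ENNReal.toReal_prod]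
  calc c ^ q = ∏ _a : Fin q, c := by simp
    _ ≤ ∏ a : Fin q, (P (A (q * j + a))).toReal :=
      Finset.prod_le_prod (fun _ _ => hc0) fun a _ => hc _

open Classical in
theorem integral_pow_card_filter_mem {ι : Type*} {A : ι → Set Ω} (hAm : ∀ j, MeasurableSet (A j))
    (hA : iIndepSet A P) (κ : ℝ) (T : Finset ι) :
    ∫ w, κ ^ (T.filter fun j => w ∈ A j).card ∂P = ∏ j ∈ T, (1 - P.real (A j) * (1 - κ)) := by
  have := hA.isProbabilityMeasure
  have hfactor : ∀ w, κ ^ (T.filter fun j => w ∈ A j).card =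
      ∏ j : T, (1 - (A j).indicator (fun _ => 1) w * (1 - κ)) := fun w => by
    rw [← Finset.prod_const, Finset.prod_filter,
      Finset.prod_coe_sort T fun j => 1 - (A j).indicator (fun _ => (1 : ℝ)) w * (1 - κ)]
    refine Finset.prod_congr rfl fun j _ => ?_
    by_cases hj : w ∈ A j <;> simp [hj]
  have hind : iIndepFun (fun (j : T) w => 1 - (A j).indicator (fun _ => (1 : ℝ)) w * (1 - κ)) P :=
    ((hA.iIndepFun_indicator (β := ℝ)).precomp Subtype.val_injective).comp
      (fun _ x => 1 - x * (1 - κ)) fun _ => by fun_prop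
  have hint : ∀ j, Integrable ((A j).indicator fun _ => (1 : ℝ)) P := fun j =>
    (integrable_const 1).indicator (hAm j)
  simp only [hfactor]
  rw [hind.integral_fun_prod_eq_prod_integral fun j =>
    ((integrable_const 1).sub ((hint j).mul_const _)).aestronglyMeasurable,
    Finset.prod_coe_sort T fun j => ∫ w, 1 - (A j).indicator (fun _ => (1 : ℝ)) w * (1 - κ) ∂P]
  refine Finset.prod_congr rfl fun j _ => ?_
  rw [integral_sub (integrable_const _) ((hint j).mul_const _), integral_mul_const,
    integral_indicator_const _ (hAm j)]
  simp

end Windows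

section Random

variable {k s : ℕ} {Ω : Type*} [MeasurableSpace Ω] {P : Measure Ω} {X : ℕ → Ω → BoolFilter k}

theorem integral_pow_card_majorityWindows_le (hX : ∀ t, Measurable (X t)) (hind : iIndepFun X P)
    {c κ : ℝ} (hc0 : 0 ≤ c) (hc : ∀ t, c ≤ P.real {w | X t w = majority k}) (hκ0 : 0 ≤ κ)
    (hκ1 : κ ≤ 1) (q J : ℕ) :
    ∫ w, κ ^ (majorityWindows q J fun t => X t w).card ∂P ≤ (1 - c ^ q * (1 - κ)) ^ J := by
  classical
  have := hind.isProbabilityMeasure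
  set A : ℕ → Set Ω := fun t => X t ⁻¹' {majority k}
  have hAm : ∀ t, MeasurableSet (A t) := fun t => hX t (measurableSet_singleton _)
  have hA : iIndepSet A P := (iIndepSet_iff_meas_biInter hAm).2 fun T =>
    hind.measure_inter_preimage_eq_mul T fun _ _ => measurableSet_singleton _
  have hwindows : ∀ w, majorityWindows q J (fun t => X t w) =
      (Finset.range J).filter fun j => w ∈ ⋂ a : Fin q, A (q * j + a) := fun w =>
    Finset.filter_congr fun j _ => by simp [A, Fin.forall_iff]
  simp only [hwindows]
  rw [integral_pow_card_filter_mem (fun j => MeasurableSet.iInter fun a => hAm _)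
    (iIndepSet_windows hAm hA q)]
  calc ∏ j ∈ Finset.range J, (1 - P.real (⋂ a : Fin q, A (q * j + a)) * (1 - κ))
      ≤ ∏ _j ∈ Finset.range J, (1 - c ^ q * (1 - κ)) :=
        Finset.prod_le_prod
          (fun j _ => sub_nonneg.2 (mul_le_one₀ measureReal_le_one (sub_nonneg.2 hκ1)
            (sub_le_self 1 hκ0)))
          fun j _ => sub_le_sub_left (mul_le_mul_of_nonneg_right
            (pow_le_measureReal_window hA hc0 hc q j) (sub_nonneg.2 hκ1)) 1
    _ = (1 - c ^ q * (1 - κ)) ^ J := by rw [Finset.prod_const, Finset.card_range]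

theorem measurable_network (k s n : ℕ) :
    Measurable fun φ : ℕ → BoolFilter k => network k s n φ := by
  induction n with
  | zero => exact measurable_const
  | succ n ih =>
    have hpair : Measurable fun φ : ℕ → BoolFilter k => (network k s n fun t => φ (t + 1), φ 0) :=
      (ih.comp (measurable_pi_lambda _ fun t => measurable_pi_apply (t + 1))).prodMk
        (measurable_pi_apply 0)
    exact (measurable_of_countable
      (fun (z : ((Fin (width k s n) → Bool) → Bool) × BoolFilter k) x =>
        z.1 (convLayer k s n z.2 x))).comp hpair

theorem measurable_card_majorityWindows (q J : ℕ) :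
    Measurable fun φ : ℕ → BoolFilter k => (majorityWindows q J φ).card := by
  simp only [majorityWindows, Finset.card_filter]
  refine Finset.measurable_sum _ fun j _ => Measurable.ite ?_ measurable_const measurable_const
  simp only [Set.ofPred_forall]
  exact MeasurableSet.iInter fun a => MeasurableSet.iInter fun _ =>
    measurable_pi_apply _ (measurableSet_singleton _)

theorem measurable_weighted : Measurable (weighted (k := k)) := by
  refine measurable_pi_lambda _ fun x => measurable_to_bool ?_
  have hpos : (fun θ : Fin (2 * k + 1) → ℝ => weighted θ x) ⁻¹' {true} =
      {θ | 0 < ∑ r, θ r * sgn (x r)} := by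
    ext θ
    simp [weighted]
  rw [hpos]
  exact measurableSet_lt measurable_const
    (Finset.measurable_sum _ fun r _ => (measurable_pi_apply r).mul_const _)

theorem tendsto_pow_div {a : ℝ} (h0 : 0 ≤ a) (h1 : a < 1) {q : ℕ} (hq : 0 < q) :
    Tendsto (fun n : ℕ => a ^ (n / q)) atTop (𝓝 0) :=
  (tendsto_pow_atTop_nhds_zero_of_lt_one h0 h1).comp (Nat.tendsto_div_const_atTop hq.ne')

theorem exists_noiseCov_network_le (hk : 1 ≤ k) (hs : 2 ≤ s) {ε : ℝ} (h0 : 0 < ε)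
    (h1 : ε ≤ 1 / 2) : ∃ q : ℕ, 0 < q ∧ ∃ κ : ℝ, 0 ≤ κ ∧ κ < 1 ∧
      ∀ (n : ℕ) (φ : ℕ → BoolFilter k), (∀ a < n, IsOdd (φ a)) →
        noiseCov (network k s n φ) ε ≤ κ ^ (majorityWindows q (n / q) φ).card := by
  obtain ⟨q, hq, c, hc, hstab⟩ := exists_blockStability_network_le hk hs
  have hpos : 0 < c * (1 - (1 - 2 * ε)) := mul_pos hc (by linarith)
  refine ⟨q, hq, (1 + c * (1 - (1 - 2 * ε)))⁻¹, by positivity, inv_lt_one_of_one_lt₀ (by linarith),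
    fun n φ hφ => ?_⟩
  rw [noiseCov_eq_blockStability h0.le (by linarith)]
  exact hstab (1 - 2 * ε) (by linarith) (by linarith) n φ hφ

theorem noiseSensitive_iteratedMajority (hk : 1 ≤ k) (hs : 2 ≤ s) :
    NoiseSensitive (width k s) (iteratedMajority k s) := by
  intro ε h0 h1
  obtain ⟨q, hq, κ, hκ0, hκ1, hκ⟩ := exists_noiseCov_network_le hk hs h0 h1
  refine squeeze_zero (fun n => noiseCov_nonneg h0.le h1 _) (fun n => ?_)
    (tendsto_pow_div hκ0 hκ1 hq)
  simpa [majorityWindows, iteratedMajority] using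
    hκ n (fun _ => majority k) fun _ _ => isOdd_majority k

theorem tendsto_integral_noiseCov_network (hk : 1 ≤ k) (hs : 2 ≤ s) (hX : ∀ t, Measurable (X t))
    (hind : iIndepFun X P) (hodd : ∀ t, ∀ᵐ w ∂P, IsOdd (X t w)) {c : ℝ} (hc0 : 0 < c)
    (hc : ∀ t, c ≤ P.real {w | X t w = majority k}) {ε : ℝ} (h0 : 0 < ε) (h1 : ε ≤ 1 / 2) :
    Tendsto (fun n => ∫ w, noiseCov (network k s n fun t => X t w) ε ∂P) atTop (𝓝 0) := by
  have := hind.isProbabilityMeasure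
  obtain ⟨q, hq, κ, hκ0, hκ1, hκ⟩ := exists_noiseCov_network_le hk hs h0 h1
  have hcq0 : 0 < c ^ q := pow_pos hc0 q
  have hcq1 : c ^ q ≤ 1 := pow_le_one₀ hc0.le ((hc 0).trans measureReal_le_one)
  refine squeeze_zero (fun n => integral_nonneg fun w => noiseCov_nonneg h0.le h1 _) (fun n => ?_)
    (tendsto_pow_div (a := 1 - c ^ q * (1 - κ)) (by nlinarith) (by nlinarith) hq)
  have hint : Integrable (fun w => κ ^ (majorityWindows q (n / q) fun t => X t w).card) P :=
    .of_bound (C := 1) ((measurable_of_countable (κ ^ ·)).comp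
      ((measurable_card_majorityWindows q _).comp (measurable_pi_lambda _ hX))).aestronglyMeasurable
      (ae_of_all _ fun w => by
        rw [Real.norm_of_nonneg (pow_nonneg hκ0 _)]
        exact pow_le_one₀ hκ0 hκ1.le)
  calc ∫ w, noiseCov (network k s n fun t => X t w) ε ∂P
      ≤ ∫ w, κ ^ (majorityWindows q (n / q) fun t => X t w).card ∂P :=
        integral_mono_of_nonneg (ae_of_all _ fun w => noiseCov_nonneg h0.le h1 _) hint
          ((ae_all_iff.2 hodd).mono fun w hw => hκ n _ fun a _ => hw a)
    _ ≤ (1 - c ^ q * (1 - κ)) ^ (n / q) :=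
        integral_pow_card_majorityWindows_le hX hind hc0.le hc hκ0 hκ1.le q _

end Random

section RandomFunctions

variable {N : ℕ → ℕ} {π : ∀ n, Measure ((Fin (N n) → Bool) → Bool)}
  [∀ n, IsProbabilityMeasure (π n)]

theorem annealedNoiseSensitive_of_tendsto (hodd : ∀ n, ∀ᵐ f ∂π n, IsOdd f)
    (hlim : ∀ ε : ℝ, 0 < ε → ε ≤ 1 / 2 → Tendsto (fun n => ∫ f, noiseCov f ε ∂π n) atTop (𝓝 0)) :
    AnnealedNoiseSensitive N π := fun ε h0 h1 =>
  (hlim ε h0 h1).congr fun n => (covariance_prod_noiseLaw h0.le (by linarith) (hodd n)).symm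

theorem quenchedNoiseSensitive_of_tendsto
    (hlim : ∀ ε : ℝ, 0 < ε → ε ≤ 1 / 2 → Tendsto (fun n => ∫ f, noiseCov f ε ∂π n) atTop (𝓝 0)) :
    QuenchedNoiseSensitive N π := by
  intro ε h0 h1 δ hδ
  obtain ⟨n₀, hn₀⟩ := eventually_atTop.1 ((hlim ε h0 h1).eventually_lt_const (mul_pos hδ hδ))
  refine ⟨n₀, fun n hn => ?_⟩
  have hmarkov : δ * (π n).real {f | δ ≤ noiseCov f ε} ≤ ∫ f, noiseCov f ε ∂π n :=
    mul_meas_ge_le_integral_of_nonneg (ae_of_all _ fun f => noiseCov_nonneg h0.le h1 f)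
      Integrable.of_finite δ
  have hlarge : (π n).real {f | δ ≤ noiseCov f ε} ≤ δ :=
    le_of_mul_le_mul_left (hmarkov.trans (hn₀ n hn).le) hδ
  calc 1 - δ ≤ 1 - (π n).real {f | δ ≤ noiseCov f ε} := sub_le_sub_left hlarge 1
    _ = (π n).real {f | δ ≤ noiseCov f ε}ᶜ :=
      (probReal_compl_eq_one_sub (Set.toFinite _).measurableSet).symm
    _ ≤ (π n).real {f | noiseCov f ε ≤ δ} :=
      measureReal_mono (fun f (hf : ¬ δ ≤ _) => (not_le.1 hf).le) (measure_ne_top _ _)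

end RandomFunctions

theorem annealed_and_quenched_network {k s : ℕ} {Ω : Type*} [MeasurableSpace Ω] {P : Measure Ω}
    {X : ℕ → Ω → BoolFilter k} (hk : 1 ≤ k) (hs : 2 ≤ s) (hX : ∀ t, Measurable (X t))
    (hind : iIndepFun X P) (hodd : ∀ t, ∀ᵐ w ∂P, IsOdd (X t w))
    (hmaj : ∃ c : ℝ, 0 < c ∧ ∀ t, c ≤ P.real {w | X t w = majority k}) :
    AnnealedNoiseSensitive (width k s) (fun n => P.map fun w => network k s n fun t => X t w) ∧
    QuenchedNoiseSensitive (width k s) (fun n => P.map fun w => network k s n fun t => X t w) := by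
  obtain ⟨c, hc0, hc⟩ := hmaj
  have := hind.isProbabilityMeasure
  have hF : ∀ n, AEMeasurable (fun w => network k s n fun t => X t w) P := fun n =>
    ((measurable_network k s n).comp (measurable_pi_lambda _ hX)).aemeasurable
  have : ∀ n, IsProbabilityMeasure (P.map fun w => network k s n fun t => X t w) := fun n =>
    Measure.isProbabilityMeasure_map (hF n)
  have hlim : ∀ ε : ℝ, 0 < ε → ε ≤ 1 / 2 → Tendsto (fun n =>
      ∫ f, noiseCov f ε ∂P.map fun w => network k s n fun t => X t w) atTop (𝓝 0) :=
    fun ε h0 h1 => (tendsto_integral_noiseCov_network hk hs hX hind hodd hc0 hc h0 h1).congr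
      fun n => (integral_map (hF n) (measurable_of_countable _).aestronglyMeasurable).symm
  refine ⟨annealedNoiseSensitive_of_tendsto (fun n => ?_) hlim,
    quenchedNoiseSensitive_of_tendsto hlim⟩
  rw [ae_map_iff (hF n) (Set.toFinite _).measurableSet]
  exact (ae_all_iff.2 hodd).mono fun w hw => IsOdd.network fun a _ => hw a

end ConvMaj

open ConvMaj in
theorem mainTheorem11_general (k s : ℕ) (hk : 1 ≤ k) (hs : 2 ≤ s) :
    NoiseSensitive (width k s) (iteratedMajority k s) ∧
    (∀ (m d : ℕ) (j : Fin (width k s (m + d))),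
      {i : Fin (width k s m) | IsAncestor k s m d i j}.ncard ≤ 2 * k) ∧
    (∀ (Ω : Type*) [MeasurableSpace Ω] (P : Measure Ω) (φ : ℕ → Ω → BoolFilter k),
      (∀ t, Measurable (φ t)) →
      iIndepFun φ P →
      (∀ t, ∀ᵐ w ∂P, IsOdd (φ t w)) →
      (∃ c : ℝ, 0 < c ∧ ∀ t, c ≤ P.real {w | φ t w = majority k}) →
      AnnealedNoiseSensitive (width k s) (fun n => P.map fun w => network k s n fun t => φ t w) ∧
      QuenchedNoiseSensitive (width k s) (fun n => P.map fun w => network k s n fun t => φ t w)) :=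
  ⟨noiseSensitive_iteratedMajority hk hs, ncard_isAncestor_le hk hs,
    fun _ _ _ _ hφ hind hodd hmaj => annealed_and_quenched_network hk hs hφ hind hodd hmaj⟩

theorem mainTheorem11 (k s : ℕ) (hk : 1 ≤ k) (hs : 2 ≤ s) :
    ConvMaj.NoiseSensitive (ConvMaj.width k s) (ConvMaj.iteratedMajority k s) ∧
    (∀ (m d : ℕ) (j : Fin (ConvMaj.width k s (m + d))),
      {i : Fin (ConvMaj.width k s m) | ConvMaj.IsAncestor k s m d i j}.ncard ≤ 2 * k) ∧
    (∀ (Ω : Type*) [MeasurableSpace Ω] (P : Measure Ω) [IsProbabilityMeasure P]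
      (θ : ℕ → Ω → (Fin (2 * k + 1) → ℝ)),
      (∀ t, Measurable (θ t)) →
      iIndepFun θ P →
      (∀ t, ∀ᵐ w ∂P, ConvMaj.NoTies (θ t w)) →
      (∃ c : ℝ, 0 < c ∧
        ∀ t, c ≤ P.real {w | ConvMaj.weighted (θ t w) = ConvMaj.majority k}) →
      ConvMaj.AnnealedNoiseSensitive (ConvMaj.width k s)
        (fun n => P.map fun w => ConvMaj.network k s n fun t => ConvMaj.weighted (θ t w)) ∧
      ConvMaj.QuenchedNoiseSensitive (ConvMaj.width k s)
        (fun n => P.map fun w => ConvMaj.network k s n fun t => ConvMaj.weighted (θ t w))) := by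
  obtain ⟨hmaj, hanc, hrandom⟩ := mainTheorem11_general k s hk hs
  refine ⟨hmaj, hanc, fun Ω _ P _ θ hθ hind hties hc => ?_⟩
  exact hrandom Ω P (fun t w => ConvMaj.weighted (θ t w))
    (fun t => ConvMaj.measurable_weighted.comp (hθ t))
    (hind.comp (fun _ => ConvMaj.weighted) fun _ => ConvMaj.measurable_weighted)
    (fun t => (hties t).mono fun _ => ConvMaj.isOdd_weighted) hc
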